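/- Conventions. A geometric graph is a finite simple graph drawn in the plane with straight-line edges on distinct points in general position (no three collinear); it is non-crossing if any two edges without a common endpoint are disjoint closed segments. Its faces are the connected components of the complement of the union of its points and edges. Its angles are the counterclockwise angles, of size in $(0,2\pi]$, between cyclically consecutive edges at a vertex (a vertex of degree $d$ has $d$ angles; at a vertex of degree one the single angle is $2\pi$). An angle is convex if it is smaller than $\pi$. A vertex is pointed if one of its angles is larger than $\pi$, and non-pointed otherwise (so an isolated vertex is non-pointed). A simple polygon is a non-crossing drawing of a cycle. A vertex of it is a corner (resp. reflex) if the angle at it facing the interior is smaller (resp. larger) than $\pi$. A pseudo-triangle is a simple polygon with exactly three corners. A pointgon $(R,P)$ is a simple polygon $R$ together with a finite set $P$ of points in general position, consisting of the vertices of $R$ and possibly additional points in the interior of $R$. A pseudo-triangulation of $(R,P)$ is a connected non-crossing geometric graph with vertex set $P$ that contains all boundary edges of $R$, has all its edges inside the closed region $R$, and each of whose bounded faces is (the interior of) a pseudo-triangle formed by edges of the graph. Theorem. (1) Let $(R,P)$ be a pointgon with $|P|=n$ and let $r$ be the number of reflex vertices of $R$. Let $T$ be a pseudo-triangulation of $(R,P)$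 with $n_{np}$ non-pointed vertices. Then $T$ has $2n-3+(n_{np}-r)$ edges and $n-2+(n_{np}-r)$ pseudo-triangles (bounded faces). (2) Let $G$ be a connected non-crossing geometric graph with $m$ edges and $n$ vertices, $n_{np}$ of which are non-pointed. Then $G$ has finitely many bounded faces and $$m = 2n-3+(n_{np}-\bar k),$$ where the excess of corners $\bar k$ is the number of convex angles (in all faces, including the unbounded one) minus three times the number of bounded faces. -/

import Mathlib

/-! The Euclidean plane is modelled by `ℂ`. A geometric graph is a simple graph `G` on a vertex set
`V` together with a map `p : V → ℂ` placing its vertices; its edges are drawn as segments. -/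

/-- Distinct points, no three of them on a line. -/
def InGeneralPosition {V : Type*} (p : V → ℂ) : Prop :=
  Function.Injective p ∧
    ∀ i j k : V, i ≠ j → j ≠ k → i ≠ k → ¬ Collinear ℝ {p i, p j, p k}

/-- Two edges without a common endpoint are drawn as disjoint closed segments. -/
def IsNonCrossing {V : Type*} (G : SimpleGraph V) (p : V → ℂ) : Prop :=
  ∀ i j k l : V, G.Adj i j → G.Adj k l → i ≠ k → i ≠ l → j ≠ k → j ≠ l →
    Disjoint (segment ℝ (p i) (p j)) (segment ℝ (p k) (p l))

/-- The set of all points on vertices and edges. -/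
def drawing {V : Type*} (G : SimpleGraph V) (p : V → ℂ) : Set ℂ :=
  Set.range p ∪ {z | ∃ v w : V, G.Adj v w ∧ z ∈ segment ℝ (p v) (p w)}

/-- The faces: the connected components of the complement of the drawing. -/
def faces {V : Type*} (G : SimpleGraph V) (p : V → ℂ) : Set (Set ℂ) :=
  {F | ∃ z ∈ (drawing G p)ᶜ, F = connectedComponentIn (drawing G p)ᶜ z}

/-- The bounded faces. -/
def boundedFaces {V : Type*} (G : SimpleGraph V) (p : V → ℂ) : Set (Set ℂ) :=
  {F ∈ faces G p | Bornology.IsBounded F}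

open Classical in
/-- The counterclockwise angle from direction `a` to direction `b` (both nonzero), as a real number
in `(0, 2π]`; the angle from a direction to itself is `2π`. -/
noncomputable def ccwAngle (a b : ℂ) : ℝ :=
  if 0 < Complex.arg (b / a) then Complex.arg (b / a) else Complex.arg (b / a) + 2 * Real.pi

/-- The size of the angle at the vertex `v` swept counterclockwise from edge `vu` to edge `vw`. -/
noncomputable def angleSize {V : Type*} (p : V → ℂ) (v u w : V) : ℝ :=
  ccwAngle (p u - p v) (p w - p v)

/-- `(v, u, w)` is an angle of the geometric graph: `vu` and `vw` are edges, and `vw` is the first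
edge met when `vu` is rotated counterclockwise about `v`. A vertex of degree `d` has `d` angles;
for `d = 1` the only angle is `(v, u, u)`, of size `2π`. -/
def IsAngle {V : Type*} (G : SimpleGraph V) (p : V → ℂ) (v u w : V) : Prop :=
  G.Adj v u ∧ G.Adj v w ∧ ∀ x : V, G.Adj v x → angleSize p v u w ≤ angleSize p v u x

/-- Some pair of consecutive edges at `v` spans an angle larger than `π`. -/
def IsPointed {V : Type*} (G : SimpleGraph V) (p : V → ℂ) (v : V) : Prop :=
  ∃ u w : V, IsAngle G p v u w ∧ Real.pi < angleSize p v u w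

/-- The number of non-pointed vertices. -/
noncomputable def numNonPointed {V : Type*} (G : SimpleGraph V) (p : V → ℂ) : ℕ :=
  {v : V | ¬ IsPointed G p v}.ncard

/-- The convex angles of the geometric graph (in all faces, bounded or not). -/
def convexAngles {V : Type*} (G : SimpleGraph V) (p : V → ℂ) : Set (V × V × V) :=
  {a | IsAngle G p a.1 a.2.1 a.2.2 ∧ angleSize p a.1 a.2.1 a.2.2 < Real.pi}

/-- The excess of corners: convex angles minus three times the number of bounded faces. -/
noncomputable def excessOfCorners {V : Type*} (G : SimpleGraph V) (p : V → ℂ) : ℤ :=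
  ((convexAngles G p).ncard : ℤ) - 3 * ((boundedFaces G p).ncard : ℤ)

/-- The angle at `v` from edge `vu` counterclockwise to edge `vw` faces the region `F`: close to
`v`, the bisecting ray of the angle runs inside `F`. -/
def AngleFaces {V : Type*} (p : V → ℂ) (v u w : V) (F : Set ℂ) : Prop :=
  ∀ᶠ ε : ℝ in nhdsWithin 0 (Set.Ioi 0),
    p v + (ε : ℂ) * (Complex.exp (((angleSize p v u w / 2 : ℝ) : ℂ) * Complex.I) * (p u - p v)) ∈ F

/-- A simple polygon (vertices in general position): a non-crossing drawing of a cycle. -/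
structure SimplePolygon where
  k : ℕ
  three_le : 3 ≤ k
  vertex : Fin k → ℂ
  generalPosition : InGeneralPosition vertex
  nonCrossing : IsNonCrossing (SimpleGraph.cycleGraph k) vertex

namespace SimplePolygon

/-- The boundary curve. -/
def boundary (R : SimplePolygon) : Set ℂ := drawing (SimpleGraph.cycleGraph R.k) R.vertex

/-- The (open) interior region: the bounded part of the complement of the boundary curve. -/
def interior (R : SimplePolygon) : Set ℂ :=
  ⋃₀ boundedFaces (SimpleGraph.cycleGraph R.k) R.vertex

/-- Convex vertices (corners): the angle facing the interior is smaller than `π`. -/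
def corners (R : SimplePolygon) : Set (Fin R.k) :=
  {i | ∃ u w, IsAngle (SimpleGraph.cycleGraph R.k) R.vertex i u w ∧
    AngleFaces R.vertex i u w R.interior ∧ angleSize R.vertex i u w < Real.pi}

/-- Reflex vertices: the angle facing the interior is larger than `π`. -/
def reflexVertices (R : SimplePolygon) : Set (Fin R.k) :=
  {i | ∃ u w, IsAngle (SimpleGraph.cycleGraph R.k) R.vertex i u w ∧
    AngleFaces R.vertex i u w R.interior ∧ Real.pi < angleSize R.vertex i u w}

/-- A pseudo-triangle is a simple polygon with exactly three corners. -/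
def IsPseudoTriangle (R : SimplePolygon) : Prop := R.corners.ncard = 3

end SimplePolygon

/-- The region `F` is a pseudo-triangle formed by edges of the geometric graph. -/
def IsPseudoTriangularFace {V : Type*} (G : SimpleGraph V) (p : V → ℂ) (F : Set ℂ) : Prop :=
  ∃ S : SimplePolygon, S.IsPseudoTriangle ∧ F = S.interior ∧
    ∀ i j, (SimpleGraph.cycleGraph S.k).Adj i j →
      ∃ v w : V, G.Adj v w ∧ p v = S.vertex i ∧ p w = S.vertex j

/-- A pointgon `(R, P)`: a simple polygon `R` and a finite point set `P` in general position,
consisting of the vertices of `R` and of further points in the interior of `R`. -/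
structure Pointgon where
  R : SimplePolygon
  P : Finset ℂ
  generalPosition : InGeneralPosition (fun x : P => (x : ℂ))
  vertex_mem : ∀ i, R.vertex i ∈ P
  mem_interior : ∀ x ∈ P, x ∈ Set.range R.vertex ∨ x ∈ R.interior

namespace Pointgon

/-- A graph `T` on the point set `P` is a pseudo-triangulation of the pointgon `(R, P)`: it is a
connected non-crossing graph that contains the boundary edges of `R`, has all its edges in the
closed region `R`, and all of its bounded faces are pseudo-triangles. -/
structure IsPseudoTriangulation (Q : Pointgon) (T : SimpleGraph Q.P) : Prop where
  connected : T.Connected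
  nonCrossing : IsNonCrossing T (fun x : Q.P => (x : ℂ))
  boundary_adj : ∀ i j, (SimpleGraph.cycleGraph Q.R.k).Adj i j →
    T.Adj ⟨Q.R.vertex i, Q.vertex_mem i⟩ ⟨Q.R.vertex j, Q.vertex_mem j⟩
  edge_subset : ∀ a b : Q.P, T.Adj a b →
    segment ℝ (a : ℂ) (b : ℂ) ⊆ Q.R.interior ∪ Q.R.boundary
  face_pseudoTriangle : ∀ F ∈ boundedFaces T (fun x : Q.P => (x : ℂ)),
    IsPseudoTriangularFace T (fun x : Q.P => (x : ℂ)) F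

end Pointgon

/-! Everything reduces to two linear relations. Write n, m, f and c for the numbers of vertices,
edges, bounded faces and convex angles.

Euler's formula gives f = m - n + 1 (`ncard_boundedFaces`). Deleting an edge merges the faces on its
two sides (`exists_side_faces`). If the edge is not a bridge, these faces differ, because the
winding number of a closed walk through the edge jumps by one across it
(`not_same_face_both_sides`); at a leaf they agree (`side_faces_eq_of_leaf`). Induction removes
non-bridges down to a tree, and then leaf edges.

Counting angles gives c = 2m - (n - n_np) (`ncard_convexAngles`): there are 2m angles in all,
general position excludes the size π, and each pointed vertex carries exactly one angle larger than
π. Eliminating f and c gives part (2).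

For part (1) it remains to show that the excess of corners is r, that is, c = 3f + r. Every angle
faces exactly one face, and the convex angles facing a region are already those of the cycle
bounding it (`ncard_convexAngles_facing`). A pseudo-triangle thus contributes 3. The unbounded face
is the exterior of R, and a convex angle of R facing the exterior is the complement of a reflex
angle facing the interior (`SimplePolygon.reflexVertices_eq`), so it contributes r. -/

section

open Set Filter Topology

/-- The connected components of a subset of the plane. -/
def comps (U : Set ℂ) : Set (Set ℂ) := {F | ∃ z ∈ U, F = connectedComponentIn U z}

/-! ### Components of plane sets, and gluing two of them. -/

section Components

variable {U U' F F' A W L R : Set ℂ}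

lemma comps_subset (hF : F ∈ comps U) : F ⊆ U := by
  obtain ⟨z, _, rfl⟩ := hF
  exact connectedComponentIn_subset _ _

lemma comps_isPreconnected (hF : F ∈ comps U) : IsPreconnected F := by
  obtain ⟨z, _, rfl⟩ := hF
  exact isPreconnected_connectedComponentIn

lemma comps_nonempty (hF : F ∈ comps U) : F.Nonempty := by
  obtain ⟨z, hz, rfl⟩ := hF
  exact ⟨z, mem_connectedComponentIn hz⟩

lemma comps_isOpen (hU : IsOpen U) (hF : F ∈ comps U) : IsOpen F := by
  obtain ⟨z, _, rfl⟩ := hF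
  exact hU.connectedComponentIn

lemma comps_eq_connectedComponentIn (hF : F ∈ comps U) {z : ℂ} (hz : z ∈ F) :
    F = connectedComponentIn U z := by
  obtain ⟨y, _, rfl⟩ := hF
  exact connectedComponentIn_eq hz

lemma comps_eq (hF : F ∈ comps U) (hF' : F' ∈ comps U) {z : ℂ} (hz : z ∈ F) (hz' : z ∈ F') :
    F = F' := by
  rw [comps_eq_connectedComponentIn hF hz, comps_eq_connectedComponentIn hF' hz']

lemma subset_of_mem_comps (hF : F ∈ comps U) (hA : IsPreconnected A) (hAU : A ⊆ U) {z : ℂ}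
    (hz : z ∈ A) (hzF : z ∈ F) : A ⊆ F := by
  rw [comps_eq_connectedComponentIn hF hzF]
  exact hA.subset_connectedComponentIn hz hAU

lemma connectedComponentIn_mem_comps {z : ℂ} (hz : z ∈ U) : connectedComponentIn U z ∈ comps U :=
  ⟨z, hz, rfl⟩

/-- Gluing the components `L` and `R` of `U` along `U' \ U`. -/
lemma comps_glue (hU : IsOpen U) (hUU' : U ⊆ U') (hL : L ∈ comps U) (hR : R ∈ comps U)
    (hW : W = L ∪ R ∪ (U' \ U)) (hWo : IsOpen W) (hWc : IsPreconnected W) :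
    W ∈ comps U' ∧ comps U \ {L, R} = comps U' \ {W} := by
  have hWU' : W ⊆ U' := by
    rw [hW]
    exact union_subset (union_subset ((comps_subset hL).trans hUU') ((comps_subset hR).trans hUU'))
      sdiff_subset
  -- The remaining components form an open set `O`, and `U'` is the disjoint union of the open sets
  -- `W` and `O`. So the connected set `W` is a full component of `U'`, and the components inside
  -- `O` do not change.
  set O : Set ℂ := ⋃₀ (comps U \ {L, R}) with hO
  have hOo : IsOpen O := isOpen_sUnion fun K hK => comps_isOpen hU hK.1
  have hOU : O ⊆ U := sUnion_subset fun K hK => comps_subset hK.1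
  have hdisj : Disjoint W O := by
    rw [Set.disjoint_left]
    rintro z hz ⟨K, ⟨hK, hK2⟩, hzK⟩
    simp only [mem_insert_iff, mem_singleton_iff, not_or] at hK2
    rw [hW] at hz
    rcases hz with (hz | hz) | hz
    · exact hK2.1 (comps_eq hK hL hzK hz)
    · exact hK2.2 (comps_eq hK hR hzK hz)
    · exact hz.2 (comps_subset hK hzK)
  have hcover : U' ⊆ W ∪ O := by
    intro z hz
    by_cases hzU : z ∈ U
    · have hc := connectedComponentIn_mem_comps hzU
      have hzc := mem_connectedComponentIn hzU
      by_cases h : connectedComponentIn U z ∈ ({L, R} : Set (Set ℂ))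
      · left
        rw [hW]
        left
        rcases h with h | h
        · left; rwa [← h]
        · right; rwa [← h]
      · right
        exact ⟨_, ⟨hc, h⟩, hzc⟩
    · left
      rw [hW]
      exact Or.inr ⟨hz, hzU⟩
  have hWeq : ∀ z ∈ W, connectedComponentIn U' z = W := by
    intro z hz
    apply Subset.antisymm
    · exact isPreconnected_connectedComponentIn.subset_left_of_subset_union hWo hOo hdisj
        ((connectedComponentIn_subset _ _).trans hcover)
        ⟨z, mem_connectedComponentIn (hWU' hz), hz⟩
    · exact hWc.subset_connectedComponentIn hz hWU'
  have hOeq : ∀ z ∈ O, connectedComponentIn U' z = connectedComponentIn U z := by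
    intro z hz
    have hzU := hOU hz
    apply Subset.antisymm
    · apply isPreconnected_connectedComponentIn.subset_connectedComponentIn
        (mem_connectedComponentIn (hUU' hzU))
      exact (isPreconnected_connectedComponentIn.subset_right_of_subset_union hWo hOo hdisj
        ((connectedComponentIn_subset _ _).trans hcover)
        ⟨z, mem_connectedComponentIn (hUU' hzU), hz⟩).trans hOU
    · exact connectedComponentIn_mono _ hUU'
  have hWmem : W ∈ comps U' := by
    obtain ⟨z, hz⟩ := comps_nonempty hL
    have hzW : z ∈ W := by rw [hW]; exact Or.inl (Or.inl hz)
    exact ⟨z, hWU' hzW, (hWeq z hzW).symm⟩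
  refine ⟨hWmem, Subset.antisymm ?_ ?_⟩
  · rintro K hK
    obtain ⟨z, hz⟩ := comps_nonempty hK.1
    have hzO : z ∈ O := ⟨K, hK, hz⟩
    refine ⟨⟨z, hUU' (hOU hzO), ?_⟩, ?_⟩
    · rw [hOeq z hzO]
      exact comps_eq_connectedComponentIn hK.1 hz
    · rintro rfl
      exact hdisj.le_bot ⟨hz, hzO⟩
  · rintro K ⟨⟨z, hz, rfl⟩, hKW⟩
    rcases hcover hz with h | h
    · exact absurd (hWeq z h) hKW
    · rw [hOeq z h]
      obtain ⟨K, hK, hzK⟩ := h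
      rwa [← comps_eq_connectedComponentIn hK.1 hzK]

/-- Counting for an edge deletion: the side faces `l` and `r` are replaced by the merged face `w`,
so the count drops by one exactly when `l` and `r` differ. -/
lemma ncard_of_diff_pair_eq {α : Type*} {S T : Set α} {l r w : α} (hl : l ∈ S) (hr : r ∈ S)
    (hw : w ∈ T) (h : S \ {l, r} = T \ {w}) (hT : T.Finite) :
    S.Finite ∧ (l = r → S.ncard = T.ncard) ∧ (l ≠ r → S.ncard = T.ncard + 1) := by
  have hd : (S \ {l, r}).Finite := h ▸ hT.subset sdiff_subset
  have hS : S.Finite := by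
    refine (hd.union ((Set.finite_singleton r).insert l)).subset ?_
    intro x hx
    by_cases hx2 : x ∈ ({l, r} : Set α)
    · exact Or.inr hx2
    · exact Or.inl ⟨hx, hx2⟩
  have hT1 := Set.ncard_sdiff_singleton_add_one hw hT
  refine ⟨hS, ?_, ?_⟩
  · rintro rfl
    rw [Set.pair_eq_singleton] at h
    rw [← hT1, ← h, Set.ncard_sdiff_singleton_add_one hl hS]
  · intro hlr
    have h2 : ({l, r} : Set α) ⊆ S := by
      rintro x (rfl | rfl) <;> assumption
    have h3 := Set.ncard_sdiff_add_ncard_of_subset h2 hS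
    rw [Set.ncard_pair hlr, h] at h3
    omega

end Components

/-- The affine chart of the plane sending `0` to `a` and `1` to `b`. -/
def chart (a b ζ : ℂ) : ℂ := a + ζ * (b - a)

/-! ### Affine coordinates along a segment. -/

section Chart

variable {a b : ℂ}

lemma chart_inj (hab : a ≠ b) {z w : ℂ} (h : chart a b z = chart a b w) : z = w := by
  unfold chart at h
  exact mul_right_cancel₀ (sub_ne_zero.2 hab.symm) (add_left_cancel h)

lemma continuous_chart : Continuous (chart a b) := by
  unfold chart
  fun_prop

lemma dist_chart (z w : ℂ) : dist (chart a b z) (chart a b w) = ‖z - w‖ * ‖b - a‖ := by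
  rw [dist_eq_norm, ← norm_mul]
  congr 1
  unfold chart
  ring

lemma chart_zero : chart a b 0 = a := by simp [chart]
lemma chart_one : chart a b 1 = b := by simp [chart]

lemma segment_eq_chart : segment ℝ a b = {z | ∃ x : ℝ, 0 ≤ x ∧ x ≤ 1 ∧ z = chart a b x} := by
  rw [segment_eq_image']
  ext z
  simp only [mem_image, mem_Icc, mem_ofPred_eq, chart, Complex.real_smul]
  constructor
  · rintro ⟨x, hx, rfl⟩; exact ⟨x, hx.1, hx.2, rfl⟩
  · rintro ⟨x, h0, h1, rfl⟩; exact ⟨x, ⟨h0, h1⟩, rfl⟩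

lemma chart_swap (ζ : ℂ) : chart b a ζ = chart a b (1 - ζ) := by
  unfold chart; ring

end Chart

/-! ### Topology of a drawing, and the two sides of an edge. -/

section Drawing

variable {V : Type*} {G : SimpleGraph V} {p : V → ℂ}

lemma isClosed_iUnion_segment [Finite V] (r : V → V → Prop) (p : V → ℂ) :
    IsClosed {z | ∃ v w : V, r v w ∧ z ∈ segment ℝ (p v) (p w)} := by
  have : {z | ∃ v w : V, r v w ∧ z ∈ segment ℝ (p v) (p w)} =
      ⋃ v : V, ⋃ w : V, {z | r v w ∧ z ∈ segment ℝ (p v) (p w)} := by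
    ext z; simp
  rw [this]
  refine isClosed_iUnion_of_finite fun v => isClosed_iUnion_of_finite fun w => ?_
  by_cases h : r v w
  · simp only [h, true_and, ofPred_mem_eq]
    rw [segment_eq_image']
    exact (isCompact_Icc.image (by fun_prop)).isClosed
  · simp [h]

lemma isClosed_drawing [Finite V] (G : SimpleGraph V) (p : V → ℂ) : IsClosed (drawing G p) :=
  (Set.finite_range p).isClosed.union (isClosed_iUnion_segment G.Adj p)

lemma isBounded_drawing [Finite V] (G : SimpleGraph V) (p : V → ℂ) :
    Bornology.IsBounded (drawing G p) := by
  obtain ⟨r, hr⟩ := (Set.finite_range p).isBounded.subset_closedBall 0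
  refine Metric.isBounded_closedBall.subset (t := Metric.closedBall 0 r) (union_subset hr ?_)
  rintro z ⟨v, w, _, hz⟩
  exact (convex_closedBall (0 : ℂ) r).segment_subset (hr ⟨v, rfl⟩) (hr ⟨w, rfl⟩) hz

/-- General position in the form used for angles: a real quotient would put the three points on one
line. -/
lemma InGeneralPosition.im_div_ne_zero (hp : InGeneralPosition p) {a b d : V} (hab : a ≠ b)
    (had : a ≠ d) (hbd : b ≠ d) : ((p b - p a) / (p d - p a)).im ≠ 0 := by
  intro h
  have hda : p d - p a ≠ 0 := sub_ne_zero.2 fun e => had (hp.1 e).symm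
  apply hp.2 a b d hab hbd had
  rw [collinear_iff_of_mem (p₀ := p a) (by simp)]
  refine ⟨p d - p a, ?_⟩
  rintro q (rfl | rfl | rfl)
  · exact ⟨0, by simp⟩
  · refine ⟨((p b - p a) / (p d - p a)).re, ?_⟩
    have : (((p b - p a) / (p d - p a)).re : ℂ) = (p b - p a) / (p d - p a) := by
      apply Complex.ext <;> simp [h]
    simp only [Complex.real_smul, this, vadd_eq_add]
    field_simp
    ring
  · exact ⟨1, by simp⟩

lemma InGeneralPosition.chart_ne (hp : InGeneralPosition p) {a b d : V} (hab : a ≠ b)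
    (had : a ≠ d) (hbd : b ≠ d) {x y : ℝ} (hx : x ≠ 0) :
    chart (p a) (p b) x ≠ chart (p a) (p d) y := by
  intro h
  apply hp.im_div_ne_zero hab had hbd
  have hda : p d - p a ≠ 0 := sub_ne_zero.2 fun e => had (hp.1 e).symm
  have hx' : (x : ℂ) ≠ 0 := by exact_mod_cast hx
  have : (p b - p a) / (p d - p a) = ((y / x : ℝ) : ℂ) := by
    unfold chart at h
    push_cast
    rw [div_eq_div_iff hda hx']
    linear_combination h
  rw [this]
  exact Complex.ofReal_im _

lemma InGeneralPosition.chart_ne_vertex (hp : InGeneralPosition p) {a b : V} (hab : a ≠ b)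
    {x : ℝ} (hx : x ≠ 0) (hx1 : x ≠ 1) (v : V) : chart (p a) (p b) x ≠ p v := by
  have hpab : p a ≠ p b := fun e => hab (hp.1 e)
  intro h
  by_cases hva : v = a
  · subst hva
    have := chart_inj hpab (h.trans chart_zero.symm)
    exact hx (by exact_mod_cast this)
  by_cases hvb : v = b
  · subst hvb
    have := chart_inj hpab (h.trans chart_one.symm)
    exact hx1 (by exact_mod_cast this)
  · apply hp.chart_ne hab (Ne.symm hva) (Ne.symm hvb) hx (y := 1)
    rw [h, Complex.ofReal_one, chart_one]

/-- An interior point of an edge lies on no other edge. -/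
lemma eq_of_chart_mem_segment (hp : InGeneralPosition p) (hG : IsNonCrossing G p) {a b c d : V}
    (hab : G.Adj a b) (hcd : G.Adj c d) {x : ℝ} (hx : 0 < x) (hx1 : x < 1)
    (h : chart (p a) (p b) x ∈ segment ℝ (p c) (p d)) : s(c, d) = s(a, b) := by
  have hmem : chart (p a) (p b) x ∈ segment ℝ (p a) (p b) := by
    rw [segment_eq_chart]; exact ⟨x, hx.le, hx1.le, rfl⟩
  have key : ∀ {a b d : V}, a ≠ b → a ≠ d → ∀ {x : ℝ}, 0 < x →
      chart (p a) (p b) x ∈ segment ℝ (p a) (p d) → d = b := by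
    intro a b d hab had x hx h
    rw [segment_eq_chart] at h
    obtain ⟨y, -, -, h⟩ := h
    by_contra hne
    exact hp.chart_ne hab had (Ne.symm hne) hx.ne' h
  have hsw : chart (p a) (p b) x = chart (p b) (p a) ((1 - x : ℝ) : ℂ) := by
    rw [chart_swap]; congr 1; push_cast; ring
  by_cases hac : a = c
  · subst hac; rw [key hab.ne hcd.ne hx h]
  by_cases had : a = d
  · subst had; rw [segment_symm] at h; rw [key hab.ne hcd.ne' hx h]; exact Sym2.eq_swap
  by_cases hbc : b = c
  · subst hbc; rw [hsw] at h; rw [key hab.ne' hcd.ne (by linarith) h]; exact Sym2.eq_swap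
  by_cases hbd : b = d
  · subst hbd; rw [hsw, segment_symm] at h; rw [key hab.ne' hcd.ne' (by linarith) h]
  exact absurd h (Set.disjoint_left.1 (hG a b c d hab hcd hac had hbc hbd) hmem)

lemma chart_notMem_drawing_deleteEdges (hp : InGeneralPosition p) (hG : IsNonCrossing G p)
    {a b : V} (hab : G.Adj a b) {x : ℝ} (hx : 0 < x) (hx1 : x < 1) :
    chart (p a) (p b) x ∉ drawing (G.deleteEdges {s(a, b)}) p := by
  rintro (⟨v, hv⟩ | ⟨c, d, hcd, h⟩)
  · exact hp.chart_ne_vertex hab.ne hx.ne' hx1.ne v hv.symm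
  · rw [SimpleGraph.deleteEdges_adj] at hcd
    exact hcd.2 (eq_of_chart_mem_segment hp hG hab hcd.1 hx hx1 h)

lemma drawing_mono {H : SimpleGraph V} (h : H ≤ G) (p : V → ℂ) : drawing H p ⊆ drawing G p :=
  union_subset_union_right _ fun _ ⟨v, w, hvw, hz⟩ => ⟨v, w, h hvw, hz⟩

lemma IsNonCrossing.mono {H : SimpleGraph V} (h : H ≤ G) (hG : IsNonCrossing G p) :
    IsNonCrossing H p :=
  fun i j k l hij hkl => hG i j k l (h hij) (h hkl)

/-- Vertices stay in the drawing when an edge is deleted, so only the open edge is freed. -/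
lemma drawing_eq_union {a b : V} (hab : G.Adj a b) :
    drawing G p = drawing (G.deleteEdges {s(a, b)}) p ∪
      {z | ∃ x : ℝ, 0 < x ∧ x < 1 ∧ z = chart (p a) (p b) x} := by
  apply Subset.antisymm
  · have key : ∀ z ∈ segment ℝ (p a) (p b), z ∈ drawing (G.deleteEdges {s(a, b)}) p ∪
      {z | ∃ x : ℝ, 0 < x ∧ x < 1 ∧ z = chart (p a) (p b) x} := by
      intro z hz
      rw [segment_eq_chart] at hz
      obtain ⟨x, h0, h1, rfl⟩ := hz
      rcases h0.eq_or_lt with rfl | h0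
      · left; left; exact ⟨a, by rw [Complex.ofReal_zero, chart_zero]⟩
      rcases h1.eq_or_lt with rfl | h1
      · left; left; exact ⟨b, by rw [Complex.ofReal_one, chart_one]⟩
      exact Or.inr ⟨x, h0, h1, rfl⟩
    rintro z (hz | ⟨v, w, hvw, hz⟩)
    · exact Or.inl (Or.inl hz)
    · by_cases h : s(v, w) = s(a, b)
      · rw [Sym2.eq_iff] at h
        rcases h with ⟨rfl, rfl⟩ | ⟨rfl, rfl⟩
        · exact key z hz
        · rw [segment_symm] at hz; exact key z hz
      · exact Or.inl (Or.inr ⟨v, w, by rw [SimpleGraph.deleteEdges_adj]; exact ⟨hvw, h⟩, hz⟩)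
  · apply union_subset (drawing_mono (G.deleteEdges_le _) p)
    rintro z ⟨x, h0, h1, rfl⟩
    right
    refine ⟨a, b, hab, ?_⟩
    rw [segment_eq_chart]
    exact ⟨x, h0.le, h1.le, rfl⟩

/-- The two faces along an edge, and the effect of deleting the edge. -/
theorem exists_side_faces [Finite V] (hp : InGeneralPosition p) (hG : IsNonCrossing G p)
    {a b : V} (hab : G.Adj a b) : ∃ L ∈ faces G p, ∃ R ∈ faces G p,
      (∀ x : ℝ, 0 < x → x < 1 → ∀ᶠ t : ℝ in 𝓝[>] 0,
        chart (p a) (p b) (x + t * Complex.I) ∈ L) ∧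
      (∀ x : ℝ, 0 < x → x < 1 → ∀ᶠ t : ℝ in 𝓝[>] 0,
        chart (p a) (p b) (x - t * Complex.I) ∈ R) ∧
      ∃ W ∈ faces (G.deleteEdges {s(a, b)}) p,
        faces G p \ {L, R} = faces (G.deleteEdges {s(a, b)}) p \ {W} := by
  set G' := G.deleteEdges {s(a, b)} with hG'
  have hpab : p a ≠ p b := fun e => hab.ne (hp.1 e)
  have hn : 0 < ‖p b - p a‖ := norm_pos_iff.2 (sub_ne_zero.2 hpab.symm)
  set φ := chart (p a) (p b) with hφ
  have hφc : Continuous φ := continuous_chart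
  set D' := drawing G' p with hD'
  have hD'c : IsClosed D' := isClosed_drawing G' p
  have hD'ne : D'.Nonempty := ⟨p a, Or.inl ⟨a, rfl⟩⟩
  have hDo : IsOpen (drawing G p)ᶜ := (isClosed_drawing G p).isOpen_compl
  have hDD' : drawing G p = D' ∪ {z | ∃ x : ℝ, 0 < x ∧ x < 1 ∧ z = φ x} := drawing_eq_union hab
  -- `δ` is the distance from a point of the edge to the rest of the drawing, in chart units. The
  -- map `ψ` below sweeps a tube about the open edge with half-width `δ`; the tube misses everything
  -- but the edge, and its two halves lie in single faces.
  set δ : ℝ → ℝ := fun x => Metric.infDist (φ x) D' / ‖p b - p a‖ with hδ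
  have hδc : Continuous δ := by
    have : Continuous fun x : ℝ => φ x := hφc.comp Complex.continuous_ofReal
    exact ((Metric.continuous_infDist_pt D').comp this).div_const _
  have hδpos : ∀ x : ℝ, 0 < x → x < 1 → 0 < δ x := fun x h0 h1 =>
    div_pos ((hD'c.notMem_iff_infDist_pos hD'ne).1
      (chart_notMem_drawing_deleteEdges hp hG hab h0 h1)) hn
  set ψ : ℝ × ℝ → ℂ := fun q => φ (q.1 + (q.2 * δ q.1 : ℝ) * Complex.I) with hψ
  have hψc : Continuous ψ := by
    apply hφc.comp
    have : Continuous fun q : ℝ × ℝ => δ q.1 := hδc.comp continuous_fst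
    fun_prop
  have hψD' : ∀ x s : ℝ, 0 < x → x < 1 → -1 < s → s < 1 → ψ (x, s) ∉ D' := by
    intro x s h0 h1 hs hs1 hmem
    have h2 := Metric.infDist_le_dist_of_mem (x := φ x) hmem
    have h3 : dist (φ x) (ψ (x, s)) = |s| * δ x * ‖p b - p a‖ := by
      rw [hψ, hφ, dist_chart]
      congr 1
      simp only [sub_add_cancel_left, norm_neg, norm_mul, Complex.norm_I, mul_one,
        Complex.norm_real, Real.norm_eq_abs, abs_of_pos (hδpos x h0 h1)]
    have h4 : Metric.infDist (φ x) D' = δ x * ‖p b - p a‖ := by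
      rw [hδ]; field_simp
    rw [h3, h4] at h2
    have h5 : |s| < 1 := abs_lt.2 ⟨hs, hs1⟩
    have h6 : 0 < δ x * ‖p b - p a‖ := mul_pos (hδpos x h0 h1) hn
    nlinarith
  have hψD : ∀ x s : ℝ, 0 < x → x < 1 → -1 < s → s < 1 → s ≠ 0 → ψ (x, s) ∈ (drawing G p)ᶜ := by
    intro x s h0 h1 hs hs1 hs0 hmem
    rw [hDD'] at hmem
    rcases hmem with hmem | ⟨y, -, -, hy⟩
    · exact hψD' x s h0 h1 hs hs1 hmem
    · have := congrArg Complex.im (chart_inj hpab hy)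
      simp [hs0, (hδpos x h0 h1).ne'] at this
  have hpre : ∀ l u : ℝ, IsPreconnected (ψ '' (Ioo 0 1 ×ˢ Ioo l u)) := fun l u =>
    (isPreconnected_Ioo.prod isPreconnected_Ioo).image _ hψc.continuousOn
  set A := ψ '' (Ioo 0 1 ×ˢ Ioo 0 1) with hA
  set B := ψ '' (Ioo 0 1 ×ˢ Ioo (-1) 0) with hB
  set T := ψ '' (Ioo 0 1 ×ˢ Ioo (-1) 1) with hT
  have hAU : A ⊆ (drawing G p)ᶜ := by
    rintro _ ⟨⟨x, s⟩, ⟨hx, hs⟩, rfl⟩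
    exact hψD x s hx.1 hx.2 (by linarith [hs.1]) hs.2 hs.1.ne'
  have hBU : B ⊆ (drawing G p)ᶜ := by
    rintro _ ⟨⟨x, s⟩, ⟨hx, hs⟩, rfl⟩
    exact hψD x s hx.1 hx.2 hs.1 (by linarith [hs.2]) hs.2.ne
  have hzA : ψ (1 / 2, 1 / 2) ∈ A := ⟨_, ⟨by norm_num, by norm_num⟩, rfl⟩
  have hzB : ψ (1 / 2, -1 / 2) ∈ B := ⟨_, ⟨by norm_num, by norm_num⟩, rfl⟩
  have hAT : A ⊆ T := image_mono (prod_mono le_rfl (Ioo_subset_Ioo_left (by norm_num)))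
  have hBT : B ⊆ T := image_mono (prod_mono le_rfl (Ioo_subset_Ioo_right (by norm_num)))
  have hLm := connectedComponentIn_mem_comps (hAU hzA)
  have hRm := connectedComponentIn_mem_comps (hBU hzB)
  have hzL := mem_connectedComponentIn (hAU hzA)
  have hzR := mem_connectedComponentIn (hBU hzB)
  have hAL := (hpre 0 1).subset_connectedComponentIn hzA hAU
  have hBR := (hpre (-1) 0).subset_connectedComponentIn hzB hBU
  set L := connectedComponentIn (drawing G p)ᶜ (ψ (1 / 2, 1 / 2))
  set R := connectedComponentIn (drawing G p)ᶜ (ψ (1 / 2, -1 / 2))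
  have hE : D'ᶜ \ (drawing G p)ᶜ = {z | ∃ x : ℝ, 0 < x ∧ x < 1 ∧ z = φ x} := by
    rw [hDD']
    ext z
    simp only [Set.mem_sdiff, mem_compl_iff, mem_union, not_not]
    constructor
    · rintro ⟨h1, h2⟩; exact h2.resolve_left h1
    · intro h
      refine ⟨?_, Or.inr h⟩
      obtain ⟨x, h0, h1, rfl⟩ := h
      exact chart_notMem_drawing_deleteEdges hp hG hab h0 h1
  have hW : L ∪ R ∪ T = L ∪ R ∪ (D'ᶜ \ (drawing G p)ᶜ) := by
    rw [hE]
    apply Subset.antisymm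
    · apply union_subset subset_union_left
      rintro _ ⟨⟨x, s⟩, ⟨hx, hs⟩, rfl⟩
      rcases lt_trichotomy s 0 with h | h | h
      · exact Or.inl (Or.inr (hBR ⟨(x, s), ⟨hx, hs.1, h⟩, rfl⟩))
      · subst h
        exact Or.inr ⟨x, hx.1, hx.2, by simp [hψ]⟩
      · exact Or.inl (Or.inl (hAL ⟨(x, s), ⟨hx, h, hs.2⟩, rfl⟩))
    · apply union_subset_union_right
      rintro _ ⟨x, h0, h1, rfl⟩
      exact ⟨(x, 0), ⟨⟨h0, h1⟩, by norm_num⟩, by simp [hψ]⟩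
  have hTo : IsOpen T := by
    -- Inverting `ψ` explicitly describes the tube by strict inequalities between continuous
    -- functions, hence it is open.
    have h1 : T = {z | 0 < ((z - p a) / (p b - p a)).re ∧ ((z - p a) / (p b - p a)).re < 1 ∧
        |((z - p a) / (p b - p a)).im| < δ ((z - p a) / (p b - p a)).re} := by
      have hne : p b - p a ≠ 0 := sub_ne_zero.2 hpab.symm
      ext z
      constructor
      · rintro ⟨⟨x, s⟩, ⟨hx, hs⟩, rfl⟩
        have : (ψ (x, s) - p a) / (p b - p a) = x + (s * δ x : ℝ) * Complex.I := by
          simp only [hψ, hφ, chart]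
          field_simp
          ring
        have h2 : |s| < 1 := abs_lt.2 ⟨hs.1, hs.2⟩
        have h3 := hδpos x hx.1 hx.2
        simp only [mem_ofPred_eq, this]
        simp only [Complex.add_re, Complex.ofReal_re, Complex.mul_re, Complex.I_re, mul_zero,
          Complex.ofReal_im, Complex.I_im, mul_one, sub_self, add_zero, Complex.add_im,
          Complex.mul_im, zero_add, abs_mul, abs_of_pos h3]
        exact ⟨hx.1, hx.2, by nlinarith⟩
      · rintro ⟨h0, h1, h2⟩
        set ζ := (z - p a) / (p b - p a) with hζ
        have h3 := hδpos _ h0 h1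
        refine ⟨(ζ.re, ζ.im / δ ζ.re), ⟨⟨h0, h1⟩, ?_⟩, ?_⟩
        · rw [abs_lt] at h2
          constructor
          · rw [lt_div_iff₀ h3]; linarith
          · rw [div_lt_iff₀ h3]; linarith
        · simp only [hψ]
          rw [div_mul_cancel₀ _ h3.ne', Complex.re_add_im, hζ, hφ, chart]
          field_simp
          ring
    rw [h1]
    have hc : Continuous fun z : ℂ => (z - p a) / (p b - p a) := by fun_prop
    have hre := Complex.continuous_re.comp hc
    have him := Complex.continuous_im.comp hc
    exact (isOpen_lt continuous_const hre).inter ((isOpen_lt hre continuous_const).inter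
      (isOpen_lt him.abs (hδc.comp hre)))
  have hWo : IsOpen (L ∪ R ∪ T) := ((comps_isOpen hDo hLm).union (comps_isOpen hDo hRm)).union hTo
  have hWc : IsPreconnected (L ∪ R ∪ T) := by
    have h1 : IsPreconnected (L ∪ T) := (comps_isPreconnected hLm).union _ hzL (hAT hzA) (hpre _ _)
    have h2 : IsPreconnected (R ∪ (L ∪ T)) :=
      (comps_isPreconnected hRm).union _ hzR (Or.inr (hBT hzB)) h1
    convert h2 using 1
    ext; simp only [mem_union]; tauto
  obtain ⟨hWm, hWd⟩ := comps_glue (U' := D'ᶜ) hDo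
    (compl_subset_compl.2 (drawing_mono (G.deleteEdges_le _) p)) hLm hRm hW hWo hWc
  have hev : ∀ x : ℝ, 0 < x → x < 1 → ∀ᶠ t : ℝ in 𝓝[>] 0, 0 < t ∧ t < δ x := by
    intro x h0 h1
    filter_upwards [Ioo_mem_nhdsGT (hδpos x h0 h1)] with t ht using ht
  refine ⟨L, hLm, R, hRm, ?_, ?_, L ∪ R ∪ T, hWm, hWd⟩
  · intro x h0 h1
    filter_upwards [hev x h0 h1] with t ht
    have h3 := hδpos x h0 h1
    refine hAL ⟨(x, t / δ x), ⟨⟨h0, h1⟩, div_pos ht.1 h3, (div_lt_one h3).2 ht.2⟩, ?_⟩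
    simp only [hψ, div_mul_cancel₀ _ h3.ne']
  · intro x h0 h1
    filter_upwards [hev x h0 h1] with t ht
    have h3 := hδpos x h0 h1
    refine hBR ⟨(x, -(t / δ x)), ⟨⟨h0, h1⟩, ?_, ?_⟩, ?_⟩
    · have := (div_lt_one h3).2 ht.2
      simp only; linarith
    · have := div_pos ht.1 h3
      simp only; linarith
    · simp only [hψ, neg_mul, div_mul_cancel₀ _ h3.ne', Complex.ofReal_neg, sub_eq_add_neg]

end Drawing

/-! ### Winding numbers separate the two sides of a non-bridge edge. -/

section Winding

variable {V : Type*} {G : SimpleGraph V} {p : V → ℂ}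

/-- The total angle under which the drawing of a walk is seen from `z`. -/
noncomputable def walkAngle (p : V → ℂ) (z : ℂ) : ∀ {u v : V}, G.Walk u v → ℝ
  | _, _, .nil => 0
  | u, _, .cons (v := v) _ q => Complex.arg ((p v - z) / (p u - z)) + walkAngle p z q

/-- The quotient is a nonpositive real only if `z` lies between `a` and `b`; hence the angle under
which an edge is seen is continuous off that edge. -/
lemma div_mem_slitPlane {a b z : ℂ} (hz : z ∉ segment ℝ a b) :
    (b - z) / (a - z) ∈ Complex.slitPlane := by
  have haz : a - z ≠ 0 := fun h => hz (sub_eq_zero.1 h ▸ left_mem_segment ℝ a b)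
  rw [Complex.mem_slitPlane_iff]
  by_contra! h
  apply hz
  set r := (b - z) / (a - z) with hr
  have hrr : (r.re : ℂ) = r := by apply Complex.ext <;> simp [h.2]
  have h1 : 1 - r.re ≠ 0 := by linarith [h.1]
  have h1' : (1 : ℂ) - r.re ≠ 0 := by exact_mod_cast h1
  have h2 : b - z = r * (a - z) := by rw [hr]; field_simp
  rw [segment_eq_chart]
  -- From b - z = r(a - z) follows b - a = (1 - r)(z - a), which gives the parameter of `z` on the
  -- segment.
  refine ⟨1 / (1 - r.re), by apply div_nonneg <;> linarith [h.1],
    (div_le_one (by linarith [h.1])).2 (by linarith [h.1]), ?_⟩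
  unfold chart
  push_cast
  field_simp
  rw [hrr]
  linear_combination -h2

lemma continuousAt_walkAngle {z : ℂ} (hz : z ∉ drawing G p) {u v : V} (q : G.Walk u v) :
    ContinuousAt (fun z => walkAngle p z q) z := by
  induction q with
  | nil => exact continuousAt_const
  | @cons u v w h q ih =>
    have hs : z ∉ segment ℝ (p u) (p v) := fun hs => hz (Or.inr ⟨u, v, h, hs⟩)
    have hu : p u - z ≠ 0 := fun h => hz (Or.inl ⟨u, sub_eq_zero.1 h⟩)
    refine ContinuousAt.add ?_ ih
    exact (Complex.continuousAt_arg (div_mem_slitPlane hs)).comp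
      (f := fun z => (p v - z) / (p u - z)) (by fun_prop (disch := assumption))

/-- The arguments telescope modulo 2π, so a closed walk has a total angle in 2πℤ. -/
lemma coe_walkAngle {z : ℂ} (hz : z ∉ drawing G p) {u v : V} (q : G.Walk u v) :
    (walkAngle p z q : Real.Angle) = Complex.arg (p v - z) - Complex.arg (p u - z) := by
  have hne : ∀ v, p v - z ≠ 0 := fun v h => hz (Or.inl ⟨v, sub_eq_zero.1 h⟩)
  induction q with
  | nil => simp [walkAngle]
  | @cons u v w h q ih =>
    rw [walkAngle, Real.Angle.coe_add, ih, Complex.arg_div_coe_angle (hne _) (hne _)]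
    abel

/-- In the chart the edge is seen under the argument of ζ/(ζ - 1). The sign of the imaginary part
tells from which side this quotient approaches the branch cut; `c` is 1/|ζ - 1|². -/
lemma im_div_sub_one (x t : ℝ) (hx1 : x < 1) :
    ∃ c : ℝ, 0 < c ∧ ((x + t * Complex.I : ℂ) / (x + t * Complex.I - 1)).im = -(c * t) := by
  have h0 : (0 : ℝ) < Complex.normSq (x + t * Complex.I - 1) := by
    rw [Complex.normSq_pos]
    intro h
    have := congrArg Complex.re h
    simp at this
    linarith
  refine ⟨1 / Complex.normSq (x + t * Complex.I - 1), by positivity, ?_⟩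
  rw [Complex.div_im]
  simp
  field_simp
  ring

/-- The two sides of an edge which is not a bridge do not lie in the same face. -/
theorem not_same_face_both_sides [Finite V] (hp : InGeneralPosition p) (hG : IsNonCrossing G p)
    {a b : V} (hab : G.Adj a b) (hbr : ¬ G.IsBridge s(a, b)) {x : ℝ} (hx : 0 < x) (hx1 : x < 1)
    {F : Set ℂ} (hF : IsPreconnected F) (hFG : Disjoint F (drawing G p))
    (hL : ∀ᶠ t : ℝ in 𝓝[>] 0, chart (p a) (p b) (x + t * Complex.I) ∈ F)
    (hR : ∀ᶠ t : ℝ in 𝓝[>] 0, chart (p a) (p b) (x - t * Complex.I) ∈ F) : False := by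
  rw [SimpleGraph.isBridge_iff, not_not, SimpleGraph.reachable_comm] at hbr
  obtain ⟨q⟩ := hbr
  have hD' := drawing_mono (G.deleteEdges_le {s(a, b)}) p
  have hpab : p a ≠ p b := fun e => hab.ne (hp.1 e)
  have hba : p b - p a ≠ 0 := sub_ne_zero.2 hpab.symm
  -- The walk `q` leads from `b` to `a` without the edge. Off the drawing, `f` is 2π times the
  -- winding number of `q` closed up by the edge from `a` to `b`; it is continuous with values in
  -- 2πℤ, hence constant on `F`.
  set f : ℂ → ℝ := fun z => walkAngle p z q - Complex.arg ((p a - z) / (p b - z)) with hf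
  have hfc : ContinuousOn f F := by
    intro z hz
    have hzD : z ∉ drawing G p := Set.disjoint_left.1 hFG hz
    have hu : p b - z ≠ 0 := fun h => hzD (Or.inl ⟨b, sub_eq_zero.1 h⟩)
    have hs : z ∉ segment ℝ (p b) (p a) := fun hs => hzD (Or.inr ⟨b, a, hab.symm, hs⟩)
    refine ((continuousAt_walkAngle (fun h => hzD (hD' h)) q).sub ?_).continuousWithinAt
    exact (Complex.continuousAt_arg (div_mem_slitPlane hs)).comp
      (f := fun z => (p a - z) / (p b - z)) (by fun_prop (disch := assumption))
  have hfint : MapsTo (fun z => f z / (2 * Real.pi)) F (range ((↑) : ℤ → ℝ)) := by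
    intro z hz
    have hzD : z ∉ drawing G p := Set.disjoint_left.1 hFG hz
    have hne : ∀ v, p v - z ≠ 0 := fun v h => hzD (Or.inl ⟨v, sub_eq_zero.1 h⟩)
    have h : (f z : Real.Angle) = 0 := by
      rw [hf, Real.Angle.coe_sub, coe_walkAngle (fun h => hzD (hD' h)),
        Complex.arg_div_coe_angle (hne _) (hne _), sub_self]
    obtain ⟨n, hn⟩ := Real.Angle.coe_eq_zero_iff.1 h
    refine ⟨n, ?_⟩
    simp only [← hn, zsmul_eq_mul]
    field_simp
  have hdisc : IsDiscrete (range ((↑) : ℤ → ℝ)) :=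
    Int.isClosedEmbedding_coe_real.isEmbedding.isDiscrete_range
  have hconst : ∀ z ∈ F, ∀ w ∈ F, f z = f w := by
    intro z hz w hw
    have := hF.constant_of_mapsTo hdisc (hfc.div_const _) hfint hz hw
    simpa [div_left_inj', Real.pi_ne_zero] using this
  have hφ : ∀ ζ : ℂ, (p a - chart (p a) (p b) ζ) / (p b - chart (p a) (p b) ζ) = ζ / (ζ - 1) := by
    intro ζ
    have h1 : p a - chart (p a) (p b) ζ = ζ * (-(p b - p a)) := by unfold chart; ring
    have h2 : p b - chart (p a) (p b) ζ = (ζ - 1) * (-(p b - p a)) := by unfold chart; ring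
    rw [h1, h2, mul_div_mul_right _ _ (neg_ne_zero.2 hba)]
  have hx1' : (x : ℂ) - 1 ≠ 0 := by
    rw [← Complex.ofReal_one, ← Complex.ofReal_sub, Complex.ofReal_ne_zero]; linarith
  have hrx : ((x : ℂ) / (x - 1)) = ((x / (x - 1) : ℝ) : ℂ) := by push_cast; rfl
  have hre : ((x : ℂ) / (x - 1)).re < 0 := by
    rw [hrx, Complex.ofReal_re]; exact div_neg_of_pos_of_neg hx (by linarith)
  have him : ((x : ℂ) / (x - 1)).im = 0 := by rw [hrx, Complex.ofReal_im]
  have hpt : ∀ σ : ℝ, Tendsto (fun t : ℝ => (x + (σ * t : ℝ) * Complex.I : ℂ)) (𝓝[>] 0) (𝓝 x) := by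
    intro σ
    have : Continuous fun t : ℝ => (x + (σ * t : ℝ) * Complex.I : ℂ) := by fun_prop
    have h := this.tendsto 0
    simp only [mul_zero, Complex.ofReal_zero, zero_mul, add_zero] at h
    exact h.mono_left nhdsWithin_le_nhds
  have hratio : ∀ σ : ℝ, Tendsto (fun t : ℝ => ((x + (σ * t : ℝ) * Complex.I : ℂ) /
      (x + (σ * t : ℝ) * Complex.I - 1))) (𝓝[>] 0) (𝓝 (x / (x - 1))) := fun σ =>
    (hpt σ).div ((hpt σ).sub_const 1) hx1'
  have hw : ∀ σ : ℝ, Tendsto (fun t : ℝ => walkAngle p (chart (p a) (p b)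
      (x + (σ * t : ℝ) * Complex.I : ℂ)) q) (𝓝[>] 0) (𝓝 (walkAngle p (chart (p a) (p b) x) q)) :=
    fun σ => (continuousAt_walkAngle
      (chart_notMem_drawing_deleteEdges hp hG hab hx hx1) q).tendsto.comp
        ((continuous_chart.tendsto _).comp (hpt σ))
  have harg1 : Tendsto (fun t : ℝ => Complex.arg ((x + ((1 : ℝ) * t : ℝ) * Complex.I : ℂ) /
      (x + ((1 : ℝ) * t : ℝ) * Complex.I - 1))) (𝓝[>] 0) (𝓝 (-Real.pi)) := by
    refine (Complex.tendsto_arg_nhdsWithin_im_neg_of_re_neg_of_im_zero hre him).comp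
      (tendsto_nhdsWithin_of_tendsto_nhds_of_eventually_within _ (hratio 1) ?_)
    filter_upwards [self_mem_nhdsWithin] with t ht
    obtain ⟨c, hc, h⟩ := im_div_sub_one x (1 * t) hx1
    have : 0 < c * t := mul_pos hc ht
    show _ < _
    rw [h]
    linarith
  have harg2 : Tendsto (fun t : ℝ => Complex.arg ((x + ((-1 : ℝ) * t : ℝ) * Complex.I : ℂ) /
      (x + ((-1 : ℝ) * t : ℝ) * Complex.I - 1))) (𝓝[>] 0) (𝓝 Real.pi) := by
    refine (Complex.tendsto_arg_nhdsWithin_im_nonneg_of_re_neg_of_im_zero hre him).comp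
      (tendsto_nhdsWithin_of_tendsto_nhds_of_eventually_within _ (hratio (-1)) ?_)
    filter_upwards [self_mem_nhdsWithin] with t ht
    obtain ⟨c, hc, h⟩ := im_div_sub_one x (-1 * t) hx1
    have : 0 < c * t := mul_pos hc ht
    show 0 ≤ _
    rw [h]
    linarith
  -- The angle along `q` is continuous across the edge and cancels. The edge term jumps between -π
  -- and π, so the difference of `f` across the edge tends to 2π, although it vanishes throughout
  -- `F`.
  have hlim := ((hw 1).sub harg1).sub ((hw (-1)).sub harg2)
  have hzero : Tendsto (fun _ : ℝ => (0 : ℝ)) (𝓝[>] (0 : ℝ)) (𝓝 0) := tendsto_const_nhds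
  have := tendsto_nhds_unique (hzero.congr' ?_) hlim
  · have hpi := Real.pi_pos
    linarith
  · filter_upwards [hL, hR] with t h1 h2
    have h3 := hconst _ h1 _ h2
    simp only [hf, hφ] at h3
    rw [eq_comm, sub_eq_zero]
    convert h3 using 4 <;> push_cast <;> ring_nf
end Winding

/-! ### Drawings near a vertex, and edges ending in a leaf. -/

section Leaf

variable {V : Type*} {G : SimpleGraph V} {p : V → ℂ}

lemma InGeneralPosition.vertex_notMem_segment (hp : InGeneralPosition p) {v c d : V} (hcd : c ≠ d)
    (hc : v ≠ c) (hd : v ≠ d) : p v ∉ segment ℝ (p c) (p d) := by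
  rw [segment_eq_chart]
  rintro ⟨x, -, -, h⟩
  by_cases hx : x = 0
  · subst hx
    rw [Complex.ofReal_zero, chart_zero] at h
    exact hc (hp.1 h)
  by_cases hx1 : x = 1
  · subst hx1
    rw [Complex.ofReal_one, chart_one] at h
    exact hd (hp.1 h)
  exact hp.chart_ne_vertex hcd hx hx1 v h.symm

/-- Near a vertex the drawing consists of the edges at this vertex. -/
lemma exists_ball_drawing [Finite V] (hp : InGeneralPosition p) (v : V) :
    ∃ r > 0, ∀ z, dist z (p v) < r → z ∈ drawing G p → z ≠ p v →
      ∃ w, G.Adj v w ∧ z ∈ segment ℝ (p v) (p w) := by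
  -- `K` collects the other vertices and all edges not incident with `v`: a closed set that misses
  -- `p v`.
  set K : Set ℂ := p '' {v}ᶜ ∪
    {z | ∃ c d : V, (G.Adj c d ∧ v ≠ c ∧ v ≠ d) ∧ z ∈ segment ℝ (p c) (p d)} with hK
  have hKc : IsClosed K := ((Set.toFinite {v}ᶜ).image p).isClosed.union
    (isClosed_iUnion_segment (fun c d => G.Adj c d ∧ v ≠ c ∧ v ≠ d) p)
  have hv : p v ∈ Kᶜ := by
    rintro (⟨w, hw, h⟩ | ⟨c, d, ⟨hcd, hc, hd⟩, h⟩)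
    · exact hw (hp.1 h)
    · exact hp.vertex_notMem_segment hcd.ne hc hd h
  obtain ⟨r, hr, h⟩ := Metric.isOpen_iff.1 hKc.isOpen_compl _ hv
  refine ⟨r, hr, fun z hz hzD hzv => ?_⟩
  have hzK : z ∉ K := h hz
  rcases hzD with ⟨w, rfl⟩ | ⟨c, d, hcd, hz⟩
  · exact absurd (Or.inl ⟨w, fun e => hzv (congrArg p e), rfl⟩) hzK
  · by_cases hc : v = c
    · subst hc; exact ⟨d, hcd, hz⟩
    by_cases hd : v = d
    · subst hd; exact ⟨c, hcd.symm, by rwa [segment_symm]⟩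
    exact absurd (Or.inr ⟨c, d, ⟨hcd, hc, hd⟩, hz⟩) hzK

lemma isPreconnected_slitPlane_inter_ball {ρ : ℝ} (hρ : 0 < ρ) :
    IsPreconnected (Complex.slitPlane ∩ Metric.ball 0 ρ) := by
  have hmem : ((ρ / 2 : ℝ) : ℂ) ∈ Metric.ball (0 : ℂ) ρ := by
    rw [mem_ball_zero_iff, Complex.norm_real, Real.norm_of_nonneg (by linarith)]
    linarith
  have h1 : StarConvex ℝ ((ρ / 2 : ℝ) : ℂ) Complex.slitPlane :=
    Complex.starConvex_slitPlane (by exact_mod_cast half_pos hρ)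
  have h2 : StarConvex ℝ ((ρ / 2 : ℝ) : ℂ) (Metric.ball (0 : ℂ) ρ) :=
    (convex_ball (0 : ℂ) ρ).starConvex hmem
  have h3 : ((ρ / 2 : ℝ) : ℂ) ∈ Complex.slitPlane :=
    Complex.ofReal_mem_slitPlane.2 (half_pos hρ)
  exact ((h1.inter h2).isPathConnected ⟨h3, hmem⟩).isConnected.isPreconnected

/-- The two sides of an edge ending in a leaf lie in the same face. -/
theorem side_faces_eq_of_leaf [Finite V] (hp : InGeneralPosition p)
    {a b : V} (hab : G.Adj a b) (hleaf : ∀ v, G.Adj b v → v = a) {L R : Set ℂ}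
    (hLm : L ∈ faces G p) (hRm : R ∈ faces G p)
    (hL : ∀ x : ℝ, 0 < x → x < 1 → ∀ᶠ t : ℝ in 𝓝[>] 0,
        chart (p a) (p b) (x + t * Complex.I) ∈ L)
    (hR : ∀ x : ℝ, 0 < x → x < 1 → ∀ᶠ t : ℝ in 𝓝[>] 0,
        chart (p a) (p b) (x - t * Complex.I) ∈ R) : L = R := by
  have hpab : p a ≠ p b := fun e => hab.ne (hp.1 e)
  have hba : 0 < ‖p b - p a‖ := norm_pos_iff.2 (sub_ne_zero.2 hpab.symm)
  obtain ⟨r, hr, h⟩ := exists_ball_drawing (G := G) hp b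
  set ρ := r / ‖p b - p a‖ with hρd
  have hρ : 0 < ρ := div_pos hr hba
  -- With the leaf moved to the origin, its only edge runs along the negative real axis. A small
  -- slit disc therefore avoids the drawing, and it connects the two sides of the edge.
  set S : Set ℂ := (fun w => chart (p a) (p b) (w + 1)) ''
    (Complex.slitPlane ∩ Metric.ball 0 ρ) with hS
  have hSc : IsPreconnected S := (isPreconnected_slitPlane_inter_ball hρ).image _
    (continuous_chart.comp (by fun_prop)).continuousOn
  have hSD : S ⊆ (drawing G p)ᶜ := by
    rintro _ ⟨w, ⟨hw, hwρ⟩, rfl⟩ hD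
    rw [mem_ball_zero_iff] at hwρ
    have hne : chart (p a) (p b) (w + 1) ≠ p b := by
      intro e
      have := chart_inj hpab (e.trans chart_one.symm)
      simp only [add_eq_right] at this
      exact Complex.slitPlane_ne_zero hw this
    have hd : dist (chart (p a) (p b) (w + 1)) (p b) < r := by
      nth_rw 2 [← chart_one (a := p a) (b := p b)]
      rw [dist_chart, add_sub_cancel_right]
      rwa [hρd, lt_div_iff₀ hba] at hwρ
    obtain ⟨v, hv, hz⟩ := h _ hd hD hne
    obtain rfl := hleaf v hv
    rw [segment_symm, segment_eq_chart] at hz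
    obtain ⟨y, -, hy1, e⟩ := hz
    have e := chart_inj hpab e
    have hwy : w = ((y - 1 : ℝ) : ℂ) := by push_cast; linear_combination e
    rw [hwy, Complex.ofReal_mem_slitPlane] at hw
    linarith
  obtain ⟨x, hx0, hx1⟩ : ∃ x : ℝ, max 0 (1 - ρ) < x ∧ x < 1 :=
    exists_between (max_lt (by norm_num) (by linarith))
  rw [max_lt_iff] at hx0
  have hev : ∀ σ : ℝ, σ ≠ 0 → ∀ᶠ t : ℝ in 𝓝[>] 0,
      chart (p a) (p b) (x + (σ * t : ℝ) * Complex.I) ∈ S := by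
    intro σ hσ
    have hc : Continuous fun t : ℝ => ‖((x - 1 : ℝ) : ℂ) + (σ * t : ℝ) * Complex.I‖ := by fun_prop
    have h1 : ∀ᶠ t : ℝ in 𝓝 0, ‖((x - 1 : ℝ) : ℂ) + (σ * t : ℝ) * Complex.I‖ < ρ := by
      apply hc.continuousAt.eventually_lt continuousAt_const
      simp only [mul_zero, Complex.ofReal_zero, zero_mul, add_zero, Complex.norm_real,
        Real.norm_eq_abs, abs_lt]
      constructor <;> linarith
    filter_upwards [nhdsWithin_le_nhds h1, self_mem_nhdsWithin] with t ht ht0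
    refine ⟨((x - 1 : ℝ) : ℂ) + (σ * t : ℝ) * Complex.I, ⟨?_, by rwa [mem_ball_zero_iff]⟩, ?_⟩
    · rw [Complex.mem_slitPlane_iff]
      right
      simpa using ⟨hσ, (ne_of_gt ht0 : t ≠ 0)⟩
    · dsimp only
      congr 1
      push_cast
      ring
  obtain ⟨t, ⟨h1, h2⟩, h3, h4⟩ := (((hev 1 one_ne_zero).and (hev (-1) (by norm_num))).and
    ((hL x hx0.1 hx1).and (hR x hx0.1 hx1))).exists
  have e1 : ((x : ℂ) + ((1 : ℝ) * t : ℝ) * Complex.I) = x + t * Complex.I := by push_cast; ring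
  have e2 : ((x : ℂ) + ((-1 : ℝ) * t : ℝ) * Complex.I) = x - t * Complex.I := by push_cast; ring
  rw [e1] at h1
  rw [e2] at h2
  exact comps_eq hLm hRm (subset_of_mem_comps hLm hSc hSD h1 h3 h2) h4

end Leaf

/-! ### Euler's formula and the unbounded face. -/

section Euler

variable {V : Type*} {G : SimpleGraph V} {p : V → ℂ}

lemma SimpleGraph.IsAcyclic.exists_leaf [Finite V] (hG : G.IsAcyclic) (hne : G ≠ ⊥) :
    ∃ a b, G.Adj a b ∧ ∀ v, G.Adj b v → v = a := by
  classical
  have := Fintype.ofFinite V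
  obtain ⟨u, w, huw⟩ := SimpleGraph.ne_bot_iff_exists_adj.1 hne
  set c := G.connectedComponentMk u with hc
  have ht := hG.isTree_connectedComponent c
  have hu : u ∈ c := rfl
  have hw : w ∈ c := (SimpleGraph.ConnectedComponent.sound huw.reachable).symm
  have : Nontrivial c := ⟨⟨u, hu⟩, ⟨w, hw⟩, fun e => huw.ne (congrArg Subtype.val e)⟩
  obtain ⟨b, hb⟩ := ht.exists_vert_degree_one_of_nontrivial
  rw [SimpleGraph.degree_eq_one_iff_existsUnique_adj] at hb
  obtain ⟨a, hab, ha⟩ := hb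
  refine ⟨a, b, hab.symm, fun v hv => ?_⟩
  have hvc : v ∈ c := by
    rw [← (SimpleGraph.ConnectedComponent.mem_supp_iff c b).1 b.2]
    exact (SimpleGraph.ConnectedComponent.sound hv.reachable).symm
  exact congrArg Subtype.val (ha ⟨v, hvc⟩ hv)

lemma ncard_edgeSet_deleteEdges [Finite V] {a b : V} (hab : G.Adj a b) :
    (G.deleteEdges {s(a, b)}).edgeSet.ncard + 1 = G.edgeSet.ncard := by
  rw [SimpleGraph.edgeSet_deleteEdges]
  exact Set.ncard_sdiff_singleton_add_one (by simpa using hab) (Set.toFinite _)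

/-- Stated for forests rather than trees, since deleting a leaf edge leaves its end behind as an
isolated vertex. In the base case the complement of a finite set is connected. -/
theorem ncard_faces_of_isAcyclic [Finite V] (hp : InGeneralPosition p) (hG : IsNonCrossing G p)
    (hac : G.IsAcyclic) : (faces G p).Finite ∧ (faces G p).ncard = 1 := by
  induction hn : G.edgeSet.ncard generalizing G with
  | zero =>
    have hbot : G = ⊥ := by
      rwa [Set.ncard_eq_zero, SimpleGraph.edgeSet_eq_empty] at hn
    subst hbot
    have hd : drawing (⊥ : SimpleGraph V) p = range p := by simp [drawing]
    have hc : IsConnected (drawing (⊥ : SimpleGraph V) p)ᶜ := by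
      rw [hd]
      exact (Set.finite_range p).countable.isConnected_compl_of_one_lt_rank (by simp)
    have : faces (⊥ : SimpleGraph V) p = {(drawing (⊥ : SimpleGraph V) p)ᶜ} := by
      apply Subset.antisymm
      · rintro _ ⟨z, hz, rfl⟩
        exact hc.isPreconnected.connectedComponentIn hz
      · rintro _ rfl
        obtain ⟨z, hz⟩ := hc.nonempty
        exact ⟨z, hz, (hc.isPreconnected.connectedComponentIn hz).symm⟩
    rw [this]
    exact ⟨Set.finite_singleton _, Set.ncard_singleton _⟩
  | succ n ih =>
    have hne : G ≠ ⊥ := by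
      rintro rfl
      simp at hn
    obtain ⟨a, b, hab, hleaf⟩ := hac.exists_leaf hne
    obtain ⟨L, hL, R, hR, hL2, hR2, W, hW, hd⟩ := exists_side_faces hp hG hab
    have hdel := ncard_edgeSet_deleteEdges hab
    obtain ⟨hf, h1⟩ := ih (hG.mono (G.deleteEdges_le {s(a, b)}))
      (hac.anti (G.deleteEdges_le _)) (by omega)
    obtain ⟨hf2, h2, -⟩ := ncard_of_diff_pair_eq hL hR hW hd hf
    exact ⟨hf2, by rw [h2 (side_faces_eq_of_leaf hp hab hleaf hL hR hL2 hR2), h1]⟩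

/-- Euler's formula for connected straight-line drawings. -/
theorem euler_formula [Finite V] (hp : InGeneralPosition p) (hG : IsNonCrossing G p)
    (hc : G.Connected) :
    (faces G p).Finite ∧ (faces G p).ncard + Nat.card V = G.edgeSet.ncard + 2 := by
  induction hn : G.edgeSet.ncard using Nat.strong_induction_on generalizing G with
  | _ n ih =>
  by_cases hac : G.IsAcyclic
  · obtain ⟨hf, h1⟩ := ncard_faces_of_isAcyclic hp hG hac
    have h2 := (SimpleGraph.isTree_iff_connected_and_card.1 ⟨hc, hac⟩).2
    rw [Nat.card_coe_set_eq] at h2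
    exact ⟨hf, by omega⟩
  · rw [SimpleGraph.isAcyclic_iff_forall_adj_isBridge] at hac
    push Not at hac
    obtain ⟨a, b, hab, hbr⟩ := hac
    obtain ⟨L, hL, R, hR, hL2, hR2, W, hW, hd⟩ := exists_side_faces hp hG hab
    have hdel := ncard_edgeSet_deleteEdges hab
    obtain ⟨hf, h1⟩ := ih _ (by omega) (hG.mono (G.deleteEdges_le {s(a, b)}))
      (hc.connected_delete_edge_of_not_isBridge hbr) rfl
    have hLR : L ≠ R := by
      rintro rfl
      exact not_same_face_both_sides hp hG hab hbr (x := 1 / 2) (by norm_num) (by norm_num)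
        (comps_isPreconnected hL) (Set.disjoint_left.2 fun z hz => comps_subset hL hz)
        (hL2 _ (by norm_num) (by norm_num)) (hR2 _ (by norm_num) (by norm_num))
    obtain ⟨hf2, -, h2⟩ := ncard_of_diff_pair_eq hL hR hW hd hf
    exact ⟨hf2, by rw [h2 hLR]; omega⟩

lemma isPreconnected_compl_ball (r : ℝ) : IsPreconnected (Metric.ball (0 : ℂ) r)ᶜ := by
  rcases le_or_gt r 0 with hr | hr
  · rw [Metric.ball_eq_empty.2 hr, compl_empty]
    exact isPreconnected_univ
  have : (Metric.ball (0 : ℂ) r)ᶜ =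
      (fun q : ℝ × ℝ => (q.1 : ℂ) * Complex.exp (q.2 * Complex.I)) '' (Ici r ×ˢ univ) := by
    ext z
    simp only [mem_compl_iff, mem_ball_zero_iff, not_lt]
    constructor
    · intro h
      exact ⟨(‖z‖, Complex.arg z), ⟨h, mem_univ _⟩, Complex.norm_mul_exp_arg_mul_I z⟩
    · rintro ⟨⟨s, t⟩, ⟨hs, -⟩, rfl⟩
      have hs : r ≤ s := hs
      simp only [norm_mul, Complex.norm_real, Complex.norm_exp_ofReal_mul_I, mul_one]
      exact hs.trans (le_abs_self s)
  rw [this]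
  exact (isPreconnected_Ici.prod isPreconnected_univ).image _ (by fun_prop)

/-- There is exactly one unbounded face. -/
theorem existsUnique_unbounded_face [Finite V] (G : SimpleGraph V) (p : V → ℂ) :
    ∃ F ∈ faces G p, ¬ Bornology.IsBounded F ∧ boundedFaces G p = faces G p \ {F} := by
  obtain ⟨r, hr⟩ := (isBounded_drawing G p).subset_ball 0
  have hsub : (Metric.ball (0 : ℂ) r)ᶜ ⊆ (drawing G p)ᶜ := compl_subset_compl.2 hr
  have hunb : ¬ Bornology.IsBounded (Metric.ball (0 : ℂ) r)ᶜ := by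
    intro h
    have := (Metric.isBounded_ball (x := (0 : ℂ)) (r := r)).union h
    rw [union_compl_self] at this
    exact NormedSpace.unbounded_univ ℝ ℂ this
  have hne : ((Metric.ball (0 : ℂ) r)ᶜ).Nonempty := by
    by_contra h
    rw [not_nonempty_iff_eq_empty] at h
    rw [h] at hunb
    exact hunb Bornology.isBounded_empty
  obtain ⟨z, hz⟩ := hne
  have hF := connectedComponentIn_mem_comps (hsub hz)
  have hFs := (isPreconnected_compl_ball r).subset_connectedComponentIn hz hsub
  have hFu : ¬ Bornology.IsBounded (connectedComponentIn (drawing G p)ᶜ z) :=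
    fun h => hunb (h.subset hFs)
  refine ⟨_, hF, hFu, ?_⟩
  ext K
  constructor
  · rintro ⟨hK, hKb⟩
    exact ⟨hK, fun e => hFu (e ▸ hKb)⟩
  · rintro ⟨hK, hKne⟩
    refine ⟨hK, Metric.isBounded_ball.subset (t := Metric.ball 0 r) fun w hw => ?_⟩
    by_contra hwr
    exact hKne (comps_eq hK hF hw (hFs hwr))

theorem ncard_boundedFaces [Finite V] (hp : InGeneralPosition p) (hG : IsNonCrossing G p)
    (hc : G.Connected) : (boundedFaces G p).Finite ∧
      (boundedFaces G p).ncard + Nat.card V = G.edgeSet.ncard + 1 := by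
  obtain ⟨hf, h⟩ := euler_formula hp hG hc
  obtain ⟨F, hF, -, hb⟩ := existsUnique_unbounded_face G p
  have := Set.ncard_sdiff_singleton_add_one hF hf
  rw [← hb] at this
  exact ⟨hb ▸ hf.subset sdiff_subset, by omega⟩

end Euler

/-! ### Arithmetic of counterclockwise angles. -/

section CcwAngle

variable {a b c : ℂ}

lemma ccwAngle_pos (a b : ℂ) : 0 < ccwAngle a b := by
  unfold ccwAngle
  split_ifs with h
  · exact h
  · have := Complex.neg_pi_lt_arg (b / a)
    have := Real.pi_pos
    linarith

lemma ccwAngle_le (a b : ℂ) : ccwAngle a b ≤ 2 * Real.pi := by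
  unfold ccwAngle
  split_ifs with h
  · have := Complex.arg_le_pi (b / a)
    have := Real.pi_pos
    linarith
  · linarith

lemma coe_ccwAngle (a b : ℂ) : (ccwAngle a b : Real.Angle) = Complex.arg (b / a) := by
  unfold ccwAngle
  split_ifs with h
  · rfl
  · rw [Real.Angle.coe_add, Real.Angle.coe_two_pi, add_zero]

/-- The interval (0, 2π] is a fundamental domain, so identities between angles may be checked modulo
2π. -/
lemma eq_of_coe_angle_eq {x y : ℝ} (hx : 0 < x) (hx2 : x ≤ 2 * Real.pi) (hy : 0 < y)
    (hy2 : y ≤ 2 * Real.pi) (h : (x : Real.Angle) = y) : x = y := by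
  obtain ⟨n, hn⟩ := Real.Angle.angle_eq_iff_two_pi_dvd_sub.1 h
  have hpi := Real.pi_pos
  have h1 : n < 1 := by
    by_contra! h1
    have : (1 : ℝ) ≤ n := by exact_mod_cast h1
    nlinarith
  have h2 : -1 < n := by
    by_contra! h1
    have : (n : ℝ) ≤ -1 := by exact_mod_cast h1
    nlinarith
  have h3 : n = 0 := by omega
  subst h3
  simp at hn
  linarith

lemma ccwAngle_self (ha : a ≠ 0) : ccwAngle a a = 2 * Real.pi := by
  simp [ccwAngle, div_self ha]

lemma ccwAngle_mul_exp (ha : a ≠ 0) {r θ : ℝ} (hr : 0 < r) (hθ : 0 < θ) (hθ2 : θ ≤ 2 * Real.pi) :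
    ccwAngle a (r * Complex.exp (θ * Complex.I) * a) = θ := by
  apply eq_of_coe_angle_eq (ccwAngle_pos _ _) (ccwAngle_le _ _) hθ hθ2
  rw [coe_ccwAngle, mul_div_cancel_right₀ _ ha, Complex.arg_real_mul _ hr, Complex.arg_exp_mul_I,
    Real.Angle.coe_toIocMod]

lemma eq_mul_exp_ccwAngle (ha : a ≠ 0) (b : ℂ) :
    b = (‖b / a‖ : ℝ) * Complex.exp (ccwAngle a b * Complex.I) * a := by
  have h : Complex.exp (ccwAngle a b * Complex.I) =
      Complex.exp (Complex.arg (b / a) * Complex.I) := by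
    unfold ccwAngle
    split_ifs
    · rfl
    · push_cast
      rw [add_mul, Complex.exp_add, Complex.exp_two_pi_mul_I, mul_one]
  rw [h, Complex.norm_mul_exp_arg_mul_I, div_mul_cancel₀ _ ha]

lemma ccwAngle_real_mul {r : ℝ} (hr : 0 < r) (a b : ℂ) : ccwAngle a (r * b) = ccwAngle a b := by
  unfold ccwAngle
  rw [mul_div_assoc, Complex.arg_real_mul _ hr]

lemma im_div_eq_zero_of_ccwAngle_eq (ha : a ≠ 0) (hc : c ≠ 0)
    (h : ccwAngle a b = ccwAngle a c) : (b / c).im = 0 := by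
  have h1 := eq_mul_exp_ccwAngle ha b
  have h2 := eq_mul_exp_ccwAngle ha c
  rw [h] at h1
  set e := Complex.exp (ccwAngle a c * Complex.I) * a with he
  have he0 : e ≠ 0 := mul_ne_zero (Complex.exp_ne_zero _) ha
  have h3 : b / c = ((‖b / a‖ / ‖c / a‖ : ℝ) : ℂ) := by
    rw [mul_assoc, ← he] at h1 h2
    have hn : ((‖c / a‖ : ℝ) : ℂ) ≠ 0 := by
      rw [Complex.ofReal_ne_zero]; exact norm_ne_zero_iff.2 (div_ne_zero hc ha)
    rw [Complex.ofReal_div]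
    generalize ((‖c / a‖ : ℝ) : ℂ) = k at h2 hn ⊢
    generalize ((‖b / a‖ : ℝ) : ℂ) = l at h1 ⊢
    rw [h1, h2, mul_div_mul_right _ _ he0]
  rw [h3, Complex.ofReal_im]

lemma ccwAngle_add_swap (ha : a ≠ 0) (hb : b ≠ 0) (h : (b / a).im ≠ 0) :
    ccwAngle a b + ccwAngle b a = 2 * Real.pi := by
  have h1 : ccwAngle a b < 2 * Real.pi := by
    refine (ccwAngle_le a b).lt_of_ne fun e => h ?_
    exact im_div_eq_zero_of_ccwAngle_eq ha ha (e.trans (ccwAngle_self ha).symm)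
  have h2 : ccwAngle b a = 2 * Real.pi - ccwAngle a b := by
    apply eq_of_coe_angle_eq (ccwAngle_pos _ _) (ccwAngle_le _ _) (by linarith)
      (by linarith [ccwAngle_pos a b])
    rw [Real.Angle.coe_sub, Real.Angle.coe_two_pi, coe_ccwAngle, coe_ccwAngle,
      Complex.arg_div_coe_angle ha hb, Complex.arg_div_coe_angle hb ha]
    abel
  linarith

lemma ccwAngle_ne_pi (h : (b / a).im ≠ 0) : ccwAngle a b ≠ Real.pi := by
  have h1 : Complex.arg (b / a) ≠ Real.pi := fun e => h (Complex.arg_eq_pi_iff.1 e).2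
  have h2 := Complex.neg_pi_lt_arg (b / a)
  unfold ccwAngle
  split_ifs
  · exact h1
  · intro e
    linarith

end CcwAngle

/-! ### Counting the angles of a geometric graph. -/

section Angles

variable {V : Type*} {G : SimpleGraph V} {p : V → ℂ}

lemma InGeneralPosition.sub_ne_zero (hp : InGeneralPosition p) {u v : V} (h : v ≠ u) :
    p u - p v ≠ 0 :=
  _root_.sub_ne_zero.2 fun e => h (hp.1 e).symm

/-- Different neighbours lie in different directions by general position, so the next edge in
counterclockwise order is unique. -/
lemma angleSize_injOn (hp : InGeneralPosition p) {v u x y : V} (hu : v ≠ u) (hx : v ≠ x)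
    (hy : v ≠ y) (h : angleSize p v u x = angleSize p v u y) : x = y := by
  by_contra hxy
  exact hp.im_div_ne_zero hx hy hxy (im_div_eq_zero_of_ccwAngle_eq (hp.sub_ne_zero hu)
    (hp.sub_ne_zero hy) h)

lemma angleSize_self (hp : InGeneralPosition p) {v u : V} (hu : v ≠ u) :
    angleSize p v u u = 2 * Real.pi :=
  ccwAngle_self (hp.sub_ne_zero hu)

lemma angleSize_add_swap (hp : InGeneralPosition p) {v u w : V} (hu : v ≠ u) (hw : v ≠ w)
    (huw : u ≠ w) : angleSize p v u w + angleSize p v w u = 2 * Real.pi :=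
  ccwAngle_add_swap (hp.sub_ne_zero hu) (hp.sub_ne_zero hw) (hp.im_div_ne_zero hw hu huw.symm)

lemma angleSize_ne_pi (hp : InGeneralPosition p) {v u w : V} (hu : v ≠ u) (hw : v ≠ w) :
    angleSize p v u w ≠ Real.pi := by
  by_cases huw : u = w
  · subst huw
    rw [angleSize_self hp hu]
    linarith [Real.pi_pos]
  · exact ccwAngle_ne_pi (hp.im_div_ne_zero hw hu (Ne.symm huw))

lemma exists_isAngle [Finite V] {v u : V} (h : G.Adj v u) : ∃ w, IsAngle G p v u w := by
  obtain ⟨w, hw, hmin⟩ := Set.exists_min_image {x | G.Adj v x} (fun x => angleSize p v u x)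
    (Set.toFinite _) ⟨u, h⟩
  exact ⟨w, h, hw, hmin⟩

lemma IsAngle.unique (hp : InGeneralPosition p) {v u w w' : V} (h : IsAngle G p v u w)
    (h' : IsAngle G p v u w') : w = w' :=
  angleSize_injOn hp h.1.ne h.2.1.ne h'.2.1.ne (le_antisymm (h.2.2 _ h'.2.1) (h'.2.2 _ h.2.1))

/-- Each directed edge is the first leg of exactly one angle. -/
lemma ncard_angles [Finite V] (hp : InGeneralPosition p) :
    {a : V × V × V | IsAngle G p a.1 a.2.1 a.2.2}.ncard = 2 * G.edgeSet.ncard := by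
  classical
  have := Fintype.ofFinite V
  have h1 : {a : V × V × V | IsAngle G p a.1 a.2.1 a.2.2}.ncard =
      {d : V × V | G.Adj d.1 d.2}.ncard := by
    apply Set.ncard_congr (fun a _ => (a.1, a.2.1))
    · intro a ha; exact ha.1
    · rintro ⟨v, u, w⟩ ⟨v', u', w'⟩ h h' e
      simp only [Prod.mk.injEq] at e
      obtain ⟨rfl, rfl⟩ := e
      exact congrArg (fun x => (v, u, x)) (IsAngle.unique hp h h')
    · rintro ⟨v, u⟩ h
      obtain ⟨w, hw⟩ := exists_isAngle (p := p) h
      exact ⟨(v, u, w), hw, rfl⟩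
  have h2 : {d : V × V | G.Adj d.1 d.2} = range (SimpleGraph.Dart.toProd (G := G)) := by
    ext d
    exact ⟨fun h => ⟨⟨d, h⟩, rfl⟩, by rintro ⟨d, rfl⟩; exact d.adj⟩
  rw [h1, h2, ← Set.image_univ, Set.ncard_image_of_injective _ SimpleGraph.Dart.toProd_injective,
    Set.ncard_univ, Nat.card_eq_fintype_card, SimpleGraph.dart_card_eq_twice_card_edges,
    ← Set.ncard_coe_finset, SimpleGraph.coe_edgeFinset]

/-- If the first legs differed, minimality would bound the two angles by those from `u` to `u'` and
from `u'` to `u`, whose sum is only 2π. -/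
lemma eq_of_isAngle_of_pi_lt (hp : InGeneralPosition p) {v u w u' w' : V}
    (h : IsAngle G p v u w) (h' : IsAngle G p v u' w') (hs : Real.pi < angleSize p v u w)
    (hs' : Real.pi < angleSize p v u' w') : u = u' := by
  by_contra hne
  have h1 := h.2.2 _ h'.1
  have h2 := h'.2.2 _ h.1
  have h3 := angleSize_add_swap hp h.1.ne h'.1.ne hne
  linarith

/-- The non-convex angles are larger than π and correspond to the pointed vertices. Isolated
vertices have no angle and count as non-pointed, so the relation covers them too. -/
theorem ncard_convexAngles [Finite V] (hp : InGeneralPosition p) (G : SimpleGraph V) :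
    (convexAngles G p).ncard + Nat.card V = 2 * G.edgeSet.ncard + numNonPointed G p := by
  have h1 : {a : V × V × V | IsAngle G p a.1 a.2.1 a.2.2} = convexAngles G p ∪
      {a | IsAngle G p a.1 a.2.1 a.2.2 ∧ Real.pi < angleSize p a.1 a.2.1 a.2.2} := by
    ext a
    constructor
    · intro h
      rcases lt_or_gt_of_ne (angleSize_ne_pi hp h.1.ne h.2.1.ne) with h2 | h2
      · exact Or.inl ⟨h, h2⟩
      · exact Or.inr ⟨h, h2⟩
    · rintro (h | h) <;> exact h.1
  have hdisj : Disjoint (convexAngles G p)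
      {a | IsAngle G p a.1 a.2.1 a.2.2 ∧ Real.pi < angleSize p a.1 a.2.1 a.2.2} :=
    Set.disjoint_left.2 fun a h h' => lt_asymm h.2 h'.2
  have h2 : {a : V × V × V | IsAngle G p a.1 a.2.1 a.2.2 ∧
      Real.pi < angleSize p a.1 a.2.1 a.2.2}.ncard = {v | IsPointed G p v}.ncard := by
    apply Set.ncard_congr (fun a _ => a.1)
    · intro a ha; exact ⟨_, _, ha⟩
    · rintro ⟨v, u, w⟩ ⟨v', u', w'⟩ h h' e
      dsimp only at e
      subst e
      have e : u = u' := eq_of_isAngle_of_pi_lt hp h.1 h'.1 h.2 h'.2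
      subst e
      exact congrArg (fun x => (v, u, x)) (IsAngle.unique hp h.1 h'.1)
    · rintro v ⟨u, w, h⟩
      exact ⟨(v, u, w), h, rfl⟩
  have h3 := ncard_angles (G := G) hp
  rw [h1, Set.ncard_union_eq hdisj (Set.toFinite _) (Set.toFinite _), h2] at h3
  have h4 : {v | IsPointed G p v}.ncard + numNonPointed G p = Nat.card V :=
    Set.ncard_add_ncard_compl {v | IsPointed G p v}
  omega

/-- At a vertex of degree two the two angles are complementary. -/
lemma IsAngle.swap_of_degree_two (hp : InGeneralPosition p) {v s t u w : V} (hst : s ≠ t)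
    (hv : ∀ x, G.Adj v x ↔ x = s ∨ x = t) (h : IsAngle G p v u w) :
    u ≠ w ∧ IsAngle G p v w u ∧ angleSize p v u w + angleSize p v w u = 2 * Real.pi := by
  have huw : u ≠ w := by
    rintro rfl
    obtain ⟨x, hx, hxu⟩ : ∃ x, G.Adj v x ∧ x ≠ u := by
      by_cases hsu : s = u
      · exact ⟨t, (hv t).2 (Or.inr rfl), fun e => hst (hsu.trans e.symm)⟩
      · exact ⟨s, (hv s).2 (Or.inl rfl), hsu⟩
    have h1 := h.2.2 x hx
    rw [angleSize_self hp h.1.ne] at h1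
    apply hxu
    apply angleSize_injOn hp h.1.ne hx.ne h.1.ne
    rw [angleSize_self hp h.1.ne]
    exact le_antisymm (ccwAngle_le _ _) h1
  refine ⟨huw, ⟨h.2.1, h.1, fun x hx => ?_⟩, angleSize_add_swap hp h.1.ne h.2.1.ne huw⟩
  have hx' : x = u ∨ x = w := by
    have h1 := (hv u).1 h.1
    have h2 := (hv w).1 h.2.1
    have h3 := (hv x).1 hx
    grind
  rcases hx' with rfl | rfl
  · exact le_rfl
  · rw [angleSize_self hp h.2.1.ne]
    exact ccwAngle_le _ _

end Angles

/-! ### Sectors and the face that an angle looks into. -/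

section Sector

/-- The open circular sector at `c` of radius `δ` swept by the counterclockwise angle `α` from
direction `d`. -/
def sector (c d : ℂ) (α δ : ℝ) : Set ℂ := {z | z ≠ c ∧ dist z c < δ ∧ ccwAngle d (z - c) < α}

lemma mem_sector_of_polar {c d : ℂ} {α δ r θ : ℝ} (hd : d ≠ 0) (hα : α ≤ 2 * Real.pi)
    (hr : 0 < r) (hrδ : r * ‖d‖ < δ) (hθ : 0 < θ) (hθα : θ < α) :
    c + r * Complex.exp (θ * Complex.I) * d ∈ sector c d α δ := by
  refine ⟨?_, ?_, ?_⟩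
  · rw [Ne, add_eq_left]
    refine mul_ne_zero (mul_ne_zero ?_ (Complex.exp_ne_zero _)) hd
    exact_mod_cast hr.ne'
  · rw [dist_eq_norm, add_sub_cancel_left, norm_mul, norm_mul, Complex.norm_real,
      Complex.norm_exp_ofReal_mul_I, mul_one, Real.norm_of_nonneg hr.le]
    exact hrδ
  · rwa [add_sub_cancel_left, ccwAngle_mul_exp hd hr hθ (by linarith)]

lemma isPreconnected_sector {c d : ℂ} {α : ℝ} (hd : d ≠ 0) (hα : α ≤ 2 * Real.pi) (δ : ℝ) :
    IsPreconnected (sector c d α δ) := by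
  have hn : 0 < ‖d‖ := norm_pos_iff.2 hd
  have : sector c d α δ = (fun q : ℝ × ℝ => c + (q.1 : ℂ) * Complex.exp (q.2 * Complex.I) * d) ''
      (Ioo 0 (δ / ‖d‖) ×ˢ Ioo 0 α) := by
    apply Subset.antisymm
    · rintro z ⟨hz, hzδ, hzα⟩
      refine ⟨(‖(z - c) / d‖, ccwAngle d (z - c)), ⟨⟨?_, ?_⟩, ccwAngle_pos _ _, hzα⟩, ?_⟩
      · exact norm_pos_iff.2 (div_ne_zero (sub_ne_zero.2 hz) hd)
      · rw [norm_div, ← dist_eq_norm]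
        exact div_lt_div_of_pos_right hzδ hn
      · dsimp only
        rw [← eq_mul_exp_ccwAngle hd (z - c)]
        ring
    · rintro _ ⟨⟨r, θ⟩, ⟨hr, hθ⟩, rfl⟩
      exact mem_sector_of_polar hd hα hr.1 ((lt_div_iff₀ hn).1 hr.2) hθ.1 hθ.2
  rw [this]
  exact (isPreconnected_Ioo.prod isPreconnected_Ioo).image _ (by fun_prop)

/-- A subset of `U` containing every connected subset of `U` that it meets. -/
def IsSaturated (U F : Set ℂ) : Prop :=
  F ⊆ U ∧ ∀ A : Set ℂ, IsPreconnected A → A ⊆ U → (A ∩ F).Nonempty → A ⊆ F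

lemma isSaturated_of_mem_comps {U F : Set ℂ} (hF : F ∈ comps U) : IsSaturated U F :=
  ⟨comps_subset hF, fun _ hA hAU ⟨_, hz, hzF⟩ => subset_of_mem_comps hF hA hAU hz hzF⟩

lemma isSaturated_sUnion {U : Set ℂ} {C : Set (Set ℂ)} (hC : C ⊆ comps U) :
    IsSaturated U (⋃₀ C) :=
  ⟨sUnion_subset fun _ hK => comps_subset (hC hK), fun _ hA hAU ⟨_, hz, _, hK, hzK⟩ =>
    (subset_of_mem_comps (hC hK) hA hAU hz hzK).trans (subset_sUnion_of_mem hK)⟩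

variable {V : Type*} {G : SimpleGraph V} {p : V → ℂ}

lemma eventually_bisector_mem_sector (hp : InGeneralPosition p) {v u w : V} (hu : v ≠ u)
    {δ : ℝ} (hδ : 0 < δ) : ∀ᶠ ε : ℝ in 𝓝[>] 0,
      p v + (ε : ℂ) * (Complex.exp (((angleSize p v u w / 2 : ℝ) : ℂ) * Complex.I) * (p u - p v)) ∈
        sector (p v) (p u - p v) (angleSize p v u w) δ := by
  have hd := hp.sub_ne_zero hu
  have hn : 0 < ‖p u - p v‖ := norm_pos_iff.2 hd
  have hα : 0 < angleSize p v u w := ccwAngle_pos _ _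
  filter_upwards [Ioo_mem_nhdsGT (div_pos hδ hn)] with ε hε
  rw [← mul_assoc]
  exact mem_sector_of_polar hd (ccwAngle_le _ _) hε.1 ((lt_div_iff₀ hn).1 hε.2) (half_pos hα)
    (half_lt_self hα)

lemma exists_sector_subset_compl [Finite V] (hp : InGeneralPosition p) {v u w : V}
    (h : IsAngle G p v u w) :
    ∃ δ > 0, sector (p v) (p u - p v) (angleSize p v u w) δ ⊆ (drawing G p)ᶜ := by
  obtain ⟨r, hr, hball⟩ := exists_ball_drawing (G := G) hp v
  refine ⟨r, hr, ?_⟩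
  rintro z ⟨hz, hzr, hzα⟩ hD
  obtain ⟨x, hx, hzx⟩ := hball z hzr hD hz
  rw [segment_eq_chart] at hzx
  obtain ⟨y, hy0, -, rfl⟩ := hzx
  have hy : 0 < y := hy0.lt_of_ne (by rintro rfl; simp [chart] at hz)
  rw [chart, add_sub_cancel_left, ccwAngle_real_mul hy] at hzα
  exact hzα.not_ge (h.2.2 x hx)

/-- `AngleFaces` tests only the bisector; since a small sector is connected and avoids the drawing,
saturation spreads the test to all of it. Saturated sets cover both single faces and the interior of
a polygon, which is defined as a union of faces. -/
lemma angleFaces_iff [Finite V] (hp : InGeneralPosition p) {v u w : V}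
    (h : IsAngle G p v u w) {F : Set ℂ} (hF : IsSaturated (drawing G p)ᶜ F) :
    AngleFaces p v u w F ↔
      ∃ δ > 0, sector (p v) (p u - p v) (angleSize p v u w) δ ⊆ F := by
  constructor
  · intro hf
    obtain ⟨δ, hδ, hs⟩ := exists_sector_subset_compl hp h
    obtain ⟨ε, h1, h2⟩ := (hf.and (eventually_bisector_mem_sector hp h.1.ne hδ)).exists
    exact ⟨δ, hδ, hF.2 _ (isPreconnected_sector (hp.sub_ne_zero h.1.ne) (ccwAngle_le _ _) δ) hs
      ⟨_, h2, h1⟩⟩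
  · rintro ⟨δ, hδ, hs⟩
    filter_upwards [eventually_bisector_mem_sector hp h.1.ne hδ] with ε hε using hs hε

lemma exists_face_angleFaces [Finite V] (hp : InGeneralPosition p) {v u w : V}
    (h : IsAngle G p v u w) : ∃ F ∈ faces G p, AngleFaces p v u w F := by
  obtain ⟨δ, hδ, hs⟩ := exists_sector_subset_compl hp h
  obtain ⟨ε, hε⟩ := (eventually_bisector_mem_sector (w := w) hp h.1.ne hδ).exists
  have hF := connectedComponentIn_mem_comps (hs hε)
  refine ⟨_, hF, (angleFaces_iff hp h (isSaturated_of_mem_comps hF)).2 ⟨δ, hδ, ?_⟩⟩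
  exact (isPreconnected_sector (hp.sub_ne_zero h.1.ne)
    (ccwAngle_le _ _) δ).subset_connectedComponentIn hε hs

lemma AngleFaces.face_eq {v u w : V} {F F' : Set ℂ} (hF : F ∈ faces G p) (hF' : F' ∈ faces G p)
    (h : AngleFaces p v u w F) (h' : AngleFaces p v u w F') : F = F' := by
  obtain ⟨ε, h1, h2⟩ := (h.and h').exists
  exact comps_eq hF hF' h1 h2

end Sector

/-! ### Angles facing a region, compared between a graph and the cycle bounding the region. -/

section SubgraphAngles

variable {V W : Type*} {G : SimpleGraph V} {p : V → ℂ} {H : SimpleGraph W} {ι : W → V}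

lemma InGeneralPosition.comp (hp : InGeneralPosition p) (hι : Function.Injective ι) :
    InGeneralPosition (p ∘ ι) :=
  ⟨hp.1.comp hι, fun _ _ _ hij hjk hik => hp.2 _ _ _ (hι.ne hij) (hι.ne hjk) (hι.ne hik)⟩

lemma mem_of_mem_closure_of_isSaturated {U F : Set ℂ} (hU : IsOpen U) (hF : IsSaturated U F)
    {z : ℂ} (hz : z ∈ closure F) (hzU : z ∈ U) : z ∈ F := by
  obtain ⟨r, hr, hb⟩ := Metric.isOpen_iff.1 hU z hzU
  obtain ⟨w, hw, hzw⟩ := Metric.mem_closure_iff.1 hz r hr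
  exact hF.2 _ (convex_ball z r).isPreconnected hb ⟨w, by rwa [Metric.mem_ball'], hw⟩
    (Metric.mem_ball_self hr)

/-- An angle of a subdrawing facing a region that is free of the whole drawing is an angle. -/
lemma IsAngle.of_subgraph [Finite W] (hp : InGeneralPosition p) (hι : Function.Injective ι)
    (hadj : ∀ i j, H.Adj i j → G.Adj (ι i) (ι j)) {F : Set ℂ}
    (hFG : IsSaturated (drawing G p)ᶜ F) (hFH : IsSaturated (drawing H (p ∘ ι))ᶜ F)
    {i u w : W} (h : IsAngle H (p ∘ ι) i u w) (hf : AngleFaces (p ∘ ι) i u w F) :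
    IsAngle G p (ι i) (ι u) (ι w) := by
  refine ⟨hadj _ _ h.1, hadj _ _ h.2.1, fun x hx => ?_⟩
  by_contra! hlt
  obtain ⟨δ, hδ, hs⟩ := (angleFaces_iff (hp.comp hι) h hFH).1 hf
  have hX : 0 < ‖p x - p (ι i)‖ := norm_pos_iff.2 (hp.sub_ne_zero hx.ne)
  obtain ⟨ε, hε0, hε⟩ := exists_between (lt_min one_pos (div_pos hδ hX))
  rw [lt_min_iff, lt_div_iff₀ hX] at hε
  -- An edge of `G` strictly inside the angle would start within the sector, hence in `F`, which
  -- avoids the drawing of `G`.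
  have hmem : chart (p (ι i)) (p x) ε ∈ F := by
    apply hs
    refine ⟨?_, ?_, ?_⟩
    · rw [chart, Ne, Function.comp_apply, add_eq_left]
      exact mul_ne_zero (by exact_mod_cast hε0.ne') (hp.sub_ne_zero hx.ne)
    · rw [chart, dist_eq_norm, Function.comp_apply, add_sub_cancel_left, norm_mul,
        Complex.norm_real, Real.norm_of_nonneg hε0.le]
      exact hε.2
    · simp only [chart, Function.comp_apply, add_sub_cancel_left, ccwAngle_real_mul hε0]
      exact hlt
  refine hFG.1 hmem (Or.inr ⟨ι i, x, hx, ?_⟩)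
  rw [segment_eq_chart]
  exact ⟨ε, hε0.le, hε.1.le, rfl⟩

/-- A point near the apex on either leg of an angle is in the closure of the sector. -/
lemma chart_mem_closure_sector {c d : ℂ} {α δ k ε σ θ₀ : ℝ} (hd : d ≠ 0) (hα : 0 < α)
    (hα2 : α ≤ 2 * Real.pi) (hk : 0 < k) (hε : 0 < ε) (hδ : ε * k * ‖d‖ < δ)
    (hθ : ∀ t : ℝ, 0 < t → t < α → 0 < θ₀ + σ * t ∧ θ₀ + σ * t < α) :
    chart c (c + k * Complex.exp (θ₀ * Complex.I) * d) ε ∈ closure (sector c d α δ) := by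
  have hc : Continuous fun t : ℝ =>
      c + ((ε * k : ℝ) : ℂ) * Complex.exp ((θ₀ + σ * t : ℝ) * Complex.I) * d := by fun_prop
  have h0 := (hc.tendsto 0).mono_left (nhdsWithin_le_nhds (s := Ioi 0))
  have : chart c (c + k * Complex.exp (θ₀ * Complex.I) * d) ε =
      c + ((ε * k : ℝ) : ℂ) * Complex.exp ((θ₀ + σ * 0 : ℝ) * Complex.I) * d := by
    unfold chart
    rw [mul_zero, add_zero]
    push_cast
    ring
  rw [this]
  refine mem_closure_of_tendsto h0 ?_
  filter_upwards [Ioo_mem_nhdsGT hα] with t ht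
  obtain ⟨h1, h2⟩ := hθ t ht.1 ht.2
  exact mem_sector_of_polar hd hα2 (mul_pos hε hk) hδ h1 h2

/-- The legs of an angle facing a region bounded by a subdrawing belong to the subdrawing. -/
lemma IsAngle.exists_of_subgraph [Finite V] [Finite W] (hp : InGeneralPosition p)
    (hG : IsNonCrossing G p) (hι : Function.Injective ι)
    (hadj : ∀ i j, H.Adj i j → G.Adj (ι i) (ι j)) {F : Set ℂ}
    (hFG : IsSaturated (drawing G p)ᶜ F) (hFH : IsSaturated (drawing H (p ∘ ι))ᶜ F)
    {v x y : V} (h : IsAngle G p v x y) (hf : AngleFaces p v x y F) :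
    ∃ i u w, ι i = v ∧ ι u = x ∧ ι w = y ∧ IsAngle H (p ∘ ι) i u w := by
  obtain ⟨δ, hδ, hs⟩ := (angleFaces_iff hp h hFG).1 hf
  set α := angleSize p v x y with hα
  have hα0 : 0 < α := ccwAngle_pos _ _
  have hα2 : α ≤ 2 * Real.pi := ccwAngle_le _ _
  have hd := hp.sub_ne_zero h.1.ne
  have hn : 0 < ‖p x - p v‖ := norm_pos_iff.2 hd
  have hleg : ∀ z, G.Adj v z → ∀ k θ₀ σ : ℝ, 0 < k →
      (∀ t : ℝ, 0 < t → t < α → 0 < θ₀ + σ * t ∧ θ₀ + σ * t < α) →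
      p z - p v = k * Complex.exp (θ₀ * Complex.I) * (p x - p v) →
      ∃ i j, ι i = v ∧ ι j = z ∧ H.Adj i j := by
    intro z hz k θ₀ σ hk hθ hzk
    have hkn := mul_pos hk hn
    obtain ⟨ε, hε0, hε⟩ := exists_between (lt_min one_pos (div_pos hδ hkn))
    rw [lt_min_iff, lt_div_iff₀ hkn] at hε
    have hcl : chart (p v) (p z) ε ∈ closure F := by
      have hpz : p z = p v + k * Complex.exp (θ₀ * Complex.I) * (p x - p v) := by
        rw [← hzk]; ring
      rw [hpz]
      exact closure_mono hs (chart_mem_closure_sector hd hα0 hα2 hk hε0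
        (by rw [mul_assoc]; exact hε.2) hθ)
    -- A point of the leg is a limit of points of `F`. Off the drawing of `H` it would belong to `F`
    -- itself, but `F` misses the edges of `G`.
    have hmem : chart (p v) (p z) ε ∈ drawing H (p ∘ ι) := by
      by_contra hnot
      refine hFG.1 (mem_of_mem_closure_of_isSaturated (isClosed_drawing _ _).isOpen_compl hFH hcl
        hnot) (Or.inr ⟨v, z, hz, ?_⟩)
      rw [segment_eq_chart]
      exact ⟨ε, hε0.le, hε.1.le, rfl⟩
    rcases hmem with ⟨i, hi⟩ | ⟨i, j, hij, hmem⟩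
    · exact absurd hi.symm (hp.chart_ne_vertex hz.ne hε0.ne' hε.1.ne _)
    · have := eq_of_chart_mem_segment hp hG hz (hadj _ _ hij) hε0 hε.1 hmem
      rw [Sym2.eq_iff] at this
      rcases this with ⟨h1, h2⟩ | ⟨h1, h2⟩
      · exact ⟨i, j, h1, h2, hij⟩
      · exact ⟨j, i, h2, h1, hij.symm⟩
  -- The first leg is approached from angle 0 upwards, the second from angle `α` downwards.
  obtain ⟨i, u, hi, hu, hiu⟩ := hleg x h.1 1 0 1 one_pos
    (fun t h1 h2 => ⟨by linarith, by linarith⟩) (by simp)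
  obtain ⟨i', w, hi', hw, hiw⟩ := hleg y h.2.1 ‖(p y - p v) / (p x - p v)‖ α (-1)
    (norm_pos_iff.2 (div_ne_zero (hp.sub_ne_zero h.2.1.ne) hd))
    (fun t h1 h2 => ⟨by linarith, by linarith⟩) (eq_mul_exp_ccwAngle hd _)
  obtain rfl := hι (hi.trans hi'.symm)
  subst hi hu hw
  exact ⟨i, u, w, rfl, rfl, rfl, hiu, hiw, fun j hj => h.2.2 _ (hadj _ _ hj)⟩

/-- To be applied with `H` the boundary cycle of a pseudo-triangle and `F` its interior, and with
`H` the boundary of R and `F` the exterior. -/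
theorem ncard_convexAngles_facing [Finite V] [Finite W] (hp : InGeneralPosition p)
    (hG : IsNonCrossing G p) (hι : Function.Injective ι)
    (hadj : ∀ i j, H.Adj i j → G.Adj (ι i) (ι j)) {F : Set ℂ}
    (hFG : IsSaturated (drawing G p)ᶜ F) (hFH : IsSaturated (drawing H (p ∘ ι))ᶜ F) :
    {a ∈ convexAngles G p | AngleFaces p a.1 a.2.1 a.2.2 F}.ncard =
      {a ∈ convexAngles H (p ∘ ι) | AngleFaces (p ∘ ι) a.1 a.2.1 a.2.2 F}.ncard := by
  symm
  apply Set.ncard_congr (fun a _ => (ι a.1, ι a.2.1, ι a.2.2))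
  · rintro ⟨i, u, w⟩ ⟨⟨h, hlt⟩, hf⟩
    exact ⟨⟨h.of_subgraph hp hι hadj hFG hFH hf, hlt⟩, hf⟩
  · rintro ⟨i, u, w⟩ ⟨i', u', w'⟩ _ _ e
    simp only [Prod.mk.injEq] at e
    rw [hι e.1, hι e.2.1, hι e.2.2]
  · rintro ⟨v, x, y⟩ ⟨⟨h, hlt⟩, hf⟩
    obtain ⟨i, u, w, rfl, rfl, rfl, ha⟩ := h.exists_of_subgraph hp hG hι hadj hFG hFH hf
    exact ⟨(i, u, w), ⟨⟨ha, hlt⟩, hf⟩, rfl⟩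

/-- The two angles at a non-bridge edge do not face the same connected region. -/
theorem not_angleFaces_both_sides [Finite V] (hp : InGeneralPosition p) (hG : IsNonCrossing G p)
    {v u w : V} (h : IsAngle G p v u w) (h' : IsAngle G p v w u) (hbr : ¬ G.IsBridge s(v, u))
    {F : Set ℂ} (hF : F ∈ faces G p) (hf : AngleFaces p v u w F) (hf' : AngleFaces p v w u F) :
    False := by
  obtain ⟨δ, hδ, hs⟩ := (angleFaces_iff hp h (isSaturated_of_mem_comps hF)).1 hf
  obtain ⟨δ', hδ', hs'⟩ := (angleFaces_iff hp h' (isSaturated_of_mem_comps hF)).1 hf'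
  have hU := hp.sub_ne_zero h.1.ne
  have hW := hp.sub_ne_zero h.2.1.ne
  have hn : 0 < ‖p u - p v‖ := norm_pos_iff.2 hU
  -- A point of the edge so close to `v` that its two sides fall into the two sectors; then the
  -- separation of the sides of a non-bridge applies.
  obtain ⟨x, hx0, hx⟩ := exists_between (lt_min one_pos (div_pos (lt_min hδ hδ') hn))
  rw [lt_min_iff, lt_div_iff₀ hn, lt_min_iff] at hx
  have hzne : ∀ ζ : ℂ, 0 < ζ.re → chart (p v) (p u) ζ ≠ p v := by
    intro ζ hζ e
    have := chart_inj (fun e => h.1.ne (hp.1 e)) (e.trans chart_zero.symm)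
    simp [this] at hζ
  have hpt : ∀ σ : ℝ, Tendsto (fun t : ℝ => (x + (σ * t : ℝ) * Complex.I : ℂ)) (𝓝[>] 0) (𝓝 x) := by
    intro σ
    have : Continuous fun t : ℝ => (x + (σ * t : ℝ) * Complex.I : ℂ) := by fun_prop
    have h := this.tendsto 0
    simp only [mul_zero, Complex.ofReal_zero, zero_mul, add_zero] at h
    exact h.mono_left nhdsWithin_le_nhds
  have hnorm : ∀ σ : ℝ, ∀ᶠ t : ℝ in 𝓝[>] 0,
      ‖(x + (σ * t : ℝ) * Complex.I : ℂ)‖ * ‖p u - p v‖ < min δ δ' := by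
    intro σ
    refine (((hpt σ).norm.mul_const _).eventually_lt_const ?_)
    rw [Complex.norm_real, Real.norm_of_nonneg hx0.le]
    exact lt_min hx.2.1 hx.2.2
  have harg : ∀ σ : ℝ, Tendsto (fun t : ℝ => Complex.arg (x + (σ * t : ℝ) * Complex.I : ℂ))
      (𝓝[>] 0) (𝓝 0) := by
    intro σ
    have h1 := (Complex.continuousAt_arg (Complex.ofReal_mem_slitPlane.2 hx0)).tendsto.comp (hpt σ)
    rwa [Complex.arg_ofReal_of_nonneg hx0.le] at h1
  have hα0 : 0 < angleSize p v u w := ccwAngle_pos _ _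
  have hβ0 : 0 < angleSize p v w u := ccwAngle_pos _ _
  apply not_same_face_both_sides hp hG h.1 hbr hx0 hx.1 (comps_isPreconnected hF)
    (Set.disjoint_left.2 fun z hz => comps_subset hF hz)
  · filter_upwards [hnorm 1, (harg 1).eventually_lt_const hα0, self_mem_nhdsWithin] with t h1 h2 ht
    rw [one_mul] at h1 h2
    have ht : 0 < t := ht
    set ζ : ℂ := x + t * Complex.I with hζ
    have him : 0 < ζ.im := by simpa [hζ] using ht
    have hz0 : ζ ≠ 0 := fun e => by simp [e] at him
    have hargpos : 0 < ζ.arg := by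
      refine (Complex.arg_nonneg_iff.2 him.le).lt_of_ne fun e => ?_
      exact him.ne' (Complex.arg_eq_zero_iff.1 e.symm).2
    apply hs
    have := mem_sector_of_polar (c := p v) hU (ccwAngle_le _ _) (norm_pos_iff.2 hz0)
      (h1.trans_le (min_le_left δ δ')) hargpos h2
    rwa [Complex.norm_mul_exp_arg_mul_I] at this
  · filter_upwards [hnorm (-1), (harg (-1)).eventually_const_lt (neg_lt_zero.2 hβ0),
      self_mem_nhdsWithin] with t h1 h2 ht
    have e : (x : ℂ) + ((-1 * t : ℝ) : ℂ) * Complex.I = x - t * Complex.I := by push_cast; ring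
    rw [e] at h1 h2
    have ht : 0 < t := ht
    set ζ : ℂ := x - t * Complex.I with hζ
    have him : ζ.im < 0 := by simpa [hζ] using ht
    have hz0 : ζ ≠ 0 := fun e => by simp [e] at him
    have hargneg : ζ.arg < 0 := Complex.arg_neg_iff.2 him
    apply hs'
    have hu := eq_mul_exp_ccwAngle hW (p u - p v)
    set k := ‖(p u - p v) / (p w - p v)‖ with hk
    have hk0 : 0 < k := norm_pos_iff.2 (div_ne_zero hU hW)
    have hkW : k * ‖p w - p v‖ = ‖p u - p v‖ := by
      rw [hk, norm_div, div_mul_cancel₀ _ (norm_ne_zero_iff.2 hW)]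
    -- Here ζ has negative argument relative to `p u - p v`; measured from `p w - p v` its angle is
    -- that of the full sector plus `ζ.arg`.
    have hmem := mem_sector_of_polar (c := p v) (d := p w - p v) (α := angleSize p v w u) (δ := δ')
      (r := ‖ζ‖ * k) (θ := angleSize p v w u + ζ.arg) hW (ccwAngle_le _ _)
      (mul_pos (norm_pos_iff.2 hz0) hk0)
      (by rw [mul_assoc, hkW]; exact h1.trans_le (min_le_right δ δ')) (by linarith) (by linarith)
    convert hmem using 1
    rw [chart]
    congr 1
    conv_lhs => rw [hu, ← Complex.norm_mul_exp_arg_mul_I ζ]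
    unfold angleSize
    push_cast
    rw [add_mul, Complex.exp_add]
    ring

/-- Each angle faces exactly one face, so the convex angles are partitioned by faces. -/
theorem ncard_convexAngles_eq_sum [Finite V] (hp : InGeneralPosition p) (hf : (faces G p).Finite) :
    (convexAngles G p).ncard =
      ∑ F ∈ hf.toFinset, {a ∈ convexAngles G p | AngleFaces p a.1 a.2.1 a.2.2 F}.ncard := by
  classical
  have hfin : (convexAngles G p).Finite := Set.toFinite _
  have hU : convexAngles G p =
      ⋃ F ∈ hf.toFinset, {a ∈ convexAngles G p | AngleFaces p a.1 a.2.1 a.2.2 F} := by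
    ext a
    simp only [mem_iUnion, Finite.mem_toFinset]
    constructor
    · intro ha
      obtain ⟨F, hF, h⟩ := exists_face_angleFaces hp ha.1
      exact ⟨F, hF, ha, h⟩
    · rintro ⟨F, -, ha, -⟩
      exact ha
  have hdisj : (hf.toFinset : Set (Set ℂ)).PairwiseDisjoint
      (fun F => (hfin.subset (sep_subset _ (fun a => AngleFaces p a.1 a.2.1 a.2.2 F))).toFinset) := by
    intro F hF F' hF' hne
    simp only [Finite.coe_toFinset] at hF hF'
    rw [Function.onFun, Finset.disjoint_left]
    intro a ha ha'
    simp only [Finite.mem_toFinset] at ha ha'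
    exact hne (AngleFaces.face_eq hF hF' ha.2 ha'.2)
  calc (convexAngles G p).ncard = hfin.toFinset.card := Set.ncard_eq_toFinset_card _ hfin
    _ = (hf.toFinset.biUnion fun F => (hfin.subset (sep_subset _
          (fun a => AngleFaces p a.1 a.2.1 a.2.2 F))).toFinset).card := by
        congr 1
        ext a
        simp only [Finset.mem_biUnion, Finite.mem_toFinset]
        conv_lhs => rw [hU]
        simp only [mem_iUnion, Finite.mem_toFinset, exists_prop]
    _ = _ := by
        rw [Finset.card_biUnion hdisj]
        refine Finset.sum_congr rfl fun F _ => ?_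
        rw [Set.ncard_eq_toFinset_card]

end SubgraphAngles

/-! ### Combinatorics of cycle graphs. -/

section Cycle

lemma cycleGraph_adj_iff_of_three_le {k : ℕ} (hk : 3 ≤ k) (i : Fin k) :
    ∃ s t, s ≠ t ∧ ∀ x, (SimpleGraph.cycleGraph k).Adj i x ↔ x = s ∨ x = t := by
  obtain ⟨n, rfl⟩ := Nat.exists_eq_add_of_le' hk
  have h := SimpleGraph.cycleGraph_degree_three_le (n := n) (v := i)
  rw [← SimpleGraph.card_neighborFinset_eq_degree, Finset.card_eq_two] at h
  obtain ⟨s, t, hst, he⟩ := h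
  refine ⟨s, t, hst, fun x => ?_⟩
  rw [← SimpleGraph.mem_neighborFinset, he]
  simp

lemma cycleGraph_connected_of_three_le {k : ℕ} (hk : 3 ≤ k) :
    (SimpleGraph.cycleGraph k).Connected := by
  obtain ⟨n, rfl⟩ := Nat.exists_eq_add_of_le' hk
  exact SimpleGraph.cycleGraph_connected

lemma ncard_edgeSet_cycleGraph {k : ℕ} (hk : 3 ≤ k) :
    (SimpleGraph.cycleGraph k).edgeSet.ncard = k := by
  classical
  obtain ⟨n, rfl⟩ := Nat.exists_eq_add_of_le' hk
  have h := (SimpleGraph.cycleGraph (n + 3)).sum_degrees_eq_twice_card_edges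
  simp only [SimpleGraph.cycleGraph_degree_three_le, Finset.sum_const, Finset.card_univ,
    Fintype.card_fin, smul_eq_mul] at h
  rw [← SimpleGraph.coe_edgeFinset, Set.ncard_coe_finset]
  omega

/-- The standard closed cycle has as many edges as the graph, so it passes through every edge, and
an edge on a cycle is no bridge. -/
lemma cycleGraph_not_isBridge {k : ℕ} (hk : 3 ≤ k) {i j : Fin k}
    (h : (SimpleGraph.cycleGraph k).Adj i j) : ¬ (SimpleGraph.cycleGraph k).IsBridge s(i, j) := by
  classical
  have hn := ncard_edgeSet_cycleGraph hk
  obtain ⟨n, rfl⟩ := Nat.exists_eq_add_of_le' hk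
  have hc := SimpleGraph.cycleGraph.isCycle_cycle (n := n)
  intro hb
  apply hb.notMem_edges_of_isCycle hc
  set q := SimpleGraph.cycleGraph.cycle n with hq
  have h1 : (q.edges.toFinset : Set (Sym2 (Fin (n + 3)))) =
      (SimpleGraph.cycleGraph (n + 3)).edgeSet := by
    apply Set.eq_of_subset_of_ncard_le
    · intro e he
      exact q.edges_subset_edgeSet (by simpa using he)
    · rw [hn, Set.ncard_coe_finset, List.toFinset_card_of_nodup hc.edges_nodup,
        SimpleGraph.Walk.length_edges, hq, SimpleGraph.cycleGraph.length_cycle]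
    · exact Set.toFinite _
  have h2 : s(i, j) ∈ (SimpleGraph.cycleGraph (n + 3)).edgeSet := h
  rw [← h1] at h2
  simpa using h2

end Cycle

/-! ### Simple polygons: the interior, corners and reflex vertices. -/

namespace SimplePolygon

variable (S : SimplePolygon)

/-- The Jordan curve theorem for polygons, read off from Euler's formula with as many edges as
vertices. -/
lemma boundedFaces_eq_singleton : ∃ K, boundedFaces (SimpleGraph.cycleGraph S.k) S.vertex = {K} := by
  obtain ⟨hf, h⟩ := ncard_boundedFaces S.generalPosition S.nonCrossing
    (cycleGraph_connected_of_three_le S.three_le)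
  rw [ncard_edgeSet_cycleGraph S.three_le, Nat.card_eq_fintype_card, Fintype.card_fin] at h
  exact Set.ncard_eq_one.1 (by omega)

lemma isAngle_swap {i u w : Fin S.k} (h : IsAngle (SimpleGraph.cycleGraph S.k) S.vertex i u w) :
    IsAngle (SimpleGraph.cycleGraph S.k) S.vertex i w u ∧
      angleSize S.vertex i u w + angleSize S.vertex i w u = 2 * Real.pi := by
  obtain ⟨s, t, hst, hadj⟩ := cycleGraph_adj_iff_of_three_le S.three_le i
  exact (h.swap_of_degree_two S.generalPosition hst hadj).2

/-- The two angles at a polygon vertex add up to 2π, so at most one is convex and counting angles is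
counting vertices. -/
lemma ncard_convexAngles_facing (F : Set ℂ) :
    {a ∈ convexAngles (SimpleGraph.cycleGraph S.k) S.vertex |
      AngleFaces S.vertex a.1 a.2.1 a.2.2 F}.ncard =
    {i | ∃ u w, IsAngle (SimpleGraph.cycleGraph S.k) S.vertex i u w ∧
      AngleFaces S.vertex i u w F ∧ angleSize S.vertex i u w < Real.pi}.ncard := by
  apply Set.ncard_congr (fun a _ => a.1)
  · rintro ⟨i, u, w⟩ ⟨⟨h, hlt⟩, hf⟩
    exact ⟨u, w, h, hf, hlt⟩
  · rintro ⟨i, u, w⟩ ⟨i', u', w'⟩ ⟨⟨h, hlt⟩, -⟩ ⟨⟨h', hlt'⟩, -⟩ e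
    dsimp only at e h hlt h' hlt'
    subst e
    obtain ⟨h1, h2⟩ := S.isAngle_swap h
    obtain ⟨h1', h2'⟩ := S.isAngle_swap h'
    obtain rfl := eq_of_isAngle_of_pi_lt S.generalPosition h1 h1' (by linarith) (by linarith)
    obtain rfl := h1.unique S.generalPosition h1'
    rfl
  · rintro i ⟨u, w, h, hf, hlt⟩
    exact ⟨(i, u, w), ⟨⟨h, hlt⟩, hf⟩, rfl⟩

/-- The reflex vertices are the vertices whose convex angle faces the exterior. -/
lemma reflexVertices_eq {E : Set ℂ} (hE : E ∈ faces (SimpleGraph.cycleGraph S.k) S.vertex)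
    (hb : boundedFaces (SimpleGraph.cycleGraph S.k) S.vertex =
      faces (SimpleGraph.cycleGraph S.k) S.vertex \ {E}) :
    S.reflexVertices = {i | ∃ u w, IsAngle (SimpleGraph.cycleGraph S.k) S.vertex i u w ∧
      AngleFaces S.vertex i u w E ∧ angleSize S.vertex i u w < Real.pi} := by
  obtain ⟨K, hK⟩ := S.boundedFaces_eq_singleton
  have hint : S.interior = K := by rw [SimplePolygon.interior, hK, sUnion_singleton]
  have hKm : K ∈ faces (SimpleGraph.cycleGraph S.k) S.vertex ∧ K ≠ E := by
    have : K ∈ faces (SimpleGraph.cycleGraph S.k) S.vertex \ {E} := by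
      rw [← hb, hK]; exact mem_singleton K
    exact this
  have hcases : ∀ F ∈ faces (SimpleGraph.cycleGraph S.k) S.vertex, F = E ∨ F = K := by
    intro F hF
    by_cases h : F = E
    · exact Or.inl h
    · right
      have : F ∈ boundedFaces (SimpleGraph.cycleGraph S.k) S.vertex := by rw [hb]; exact ⟨hF, h⟩
      rwa [hK] at this
  -- The two angles at a vertex face different faces because a cycle has no bridge; as there are
  -- only two faces, one angle determines what the other faces.
  have hopp : ∀ {i u w F F'}, IsAngle (SimpleGraph.cycleGraph S.k) S.vertex i u w →
      AngleFaces S.vertex i u w F → F ∈ faces (SimpleGraph.cycleGraph S.k) S.vertex →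
      F' ∈ faces (SimpleGraph.cycleGraph S.k) S.vertex → F ≠ F' →
      AngleFaces S.vertex i w u F' := by
    intro i u w F F' h hf hF hF' hne
    have h' := (S.isAngle_swap h).1
    obtain ⟨F₁, hF₁, hf₁⟩ := exists_face_angleFaces S.generalPosition h'
    have hne₁ : F₁ ≠ F := by
      rintro rfl
      exact not_angleFaces_both_sides S.generalPosition S.nonCrossing h h'
        (cycleGraph_not_isBridge S.three_le h.1) hF hf hf₁
    have : F₁ = F' := by
      rcases hcases F hF with rfl | rfl <;> rcases hcases F' hF' with rfl | rfl <;>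
        rcases hcases F₁ hF₁ with rfl | rfl <;> first | rfl | contradiction
    rwa [← this]
  ext i
  constructor
  · rintro ⟨u, w, h, hf, hlt⟩
    rw [hint] at hf
    obtain ⟨h1, h2⟩ := S.isAngle_swap h
    exact ⟨w, u, h1, hopp h hf hKm.1 hE hKm.2, by linarith⟩
  · rintro ⟨u, w, h, hf, hlt⟩
    obtain ⟨h1, h2⟩ := S.isAngle_swap h
    exact ⟨w, u, h1, hint ▸ hopp h hf hE hKm.1 hKm.2.symm, by linarith⟩

end SimplePolygon

theorem edges_eq_of_connected {V : Type*} [Fintype V] {G : SimpleGraph V} {p : V → ℂ}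
    (hp : InGeneralPosition p) (hG : IsNonCrossing G p) (hc : G.Connected) :
    (boundedFaces G p).Finite ∧ (G.edgeSet.ncard : ℤ) = 2 * (Fintype.card V : ℤ) - 3 +
      ((numNonPointed G p : ℤ) - excessOfCorners G p) := by
  obtain ⟨hf, h1⟩ := ncard_boundedFaces hp hG hc
  have h2 := ncard_convexAngles hp G
  rw [Nat.card_eq_fintype_card] at h1 h2
  refine ⟨hf, ?_⟩
  unfold excessOfCorners
  omega

/-! ### Convex angles in a pseudo-triangular face. -/

section PseudoTriangulation

variable {V : Type*} [Finite V] {G : SimpleGraph V} {p : V → ℂ}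

/-- The boundary of the pseudo-triangle embeds in `G` as a cycle, and the convex angles of this
cycle facing `F` are the three corners. -/
lemma ncard_convexAngles_of_isPseudoTriangularFace (hp : InGeneralPosition p)
    (hG : IsNonCrossing G p) {F : Set ℂ} (hF : F ∈ faces G p)
    (h : IsPseudoTriangularFace G p F) :
    {a ∈ convexAngles G p | AngleFaces p a.1 a.2.1 a.2.2 F}.ncard = 3 := by
  obtain ⟨S, hS, hFS, hedge⟩ := h
  have hex : ∀ i, ∃ v, p v = S.vertex i := by
    intro i
    obtain ⟨s, t, -, hadj⟩ := cycleGraph_adj_iff_of_three_le S.three_le i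
    obtain ⟨v, w, -, hv, -⟩ := hedge i s ((hadj s).2 (Or.inl rfl))
    exact ⟨v, hv⟩
  choose ι hι using hex
  have hcomp : p ∘ ι = S.vertex := funext hι
  have hinj : Function.Injective ι := by
    intro i j e
    apply S.generalPosition.1
    rw [← hι, ← hι, e]
  have hadj : ∀ i j, (SimpleGraph.cycleGraph S.k).Adj i j → G.Adj (ι i) (ι j) := by
    intro i j hij
    obtain ⟨v, w, hvw, hv, hw⟩ := hedge i j hij
    rwa [← hp.1 (hv.trans (hι i).symm), ← hp.1 (hw.trans (hι j).symm)]
  have hsat : IsSaturated (drawing (SimpleGraph.cycleGraph S.k) (p ∘ ι))ᶜ F := by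
    rw [hcomp, hFS]
    exact isSaturated_sUnion fun K hK => hK.1
  rw [ncard_convexAngles_facing hp hG hinj hadj (isSaturated_of_mem_comps hF) hsat, hcomp,
    S.ncard_convexAngles_facing, ← hS, SimplePolygon.corners, hFS]

end PseudoTriangulation

/-! ### Pseudo-triangulations of a pointgon. -/

namespace Pointgon

variable {Q : Pointgon} {T : SimpleGraph Q.P}

/-- The unbounded face of a pseudo-triangulation is the exterior of the polygon. -/
lemma IsPseudoTriangulation.unbounded_face_eq (hT : Q.IsPseudoTriangulation T) {E F : Set ℂ}
    (hE : E ∈ faces (SimpleGraph.cycleGraph Q.R.k) Q.R.vertex) (hEb : ¬ Bornology.IsBounded E)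
    (hFb : boundedFaces T (fun x : Q.P => (x : ℂ)) = faces T (fun x : Q.P => (x : ℂ)) \ {F}) :
    E = F := by
  have hdisj : ∀ z ∈ E, z ∉ Q.R.interior ∪ Q.R.boundary := by
    rintro z hz (⟨K, hK, hzK⟩ | hzb)
    · exact hEb (comps_eq hE hK.1 hz hzK ▸ hK.2)
    · exact comps_subset hE hz hzb
  -- The exterior of R avoids `T`, whose vertices and edges lie in the closed region. Conversely a
  -- face of `T` avoids the boundary of R, which is drawn by `T`; so the two unbounded faces contain
  -- each other.
  have hED : E ⊆ (drawing T (fun x : Q.P => (x : ℂ)))ᶜ := by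
    rintro z hz (⟨x, rfl⟩ | ⟨a, b, hab, hzab⟩)
    · rcases Q.mem_interior x x.2 with h | h
      · exact hdisj _ hz (Or.inr (Or.inl h))
      · exact hdisj _ hz (Or.inl h)
    · exact hdisj _ hz (hT.edge_subset a b hab hzab)
  have hRD : drawing (SimpleGraph.cycleGraph Q.R.k) Q.R.vertex ⊆
      drawing T (fun x : Q.P => (x : ℂ)) := by
    rintro z (⟨i, rfl⟩ | ⟨i, j, hij, hz⟩)
    · exact Or.inl ⟨⟨_, Q.vertex_mem i⟩, rfl⟩
    · exact Or.inr ⟨_, _, hT.boundary_adj i j hij, hz⟩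
  obtain ⟨z, hz⟩ := comps_nonempty hE
  have hC := connectedComponentIn_mem_comps (hED hz)
  have hEC := (comps_isPreconnected hE).subset_connectedComponentIn hz hED
  set C := connectedComponentIn (drawing T (fun x : Q.P => (x : ℂ)))ᶜ z
  have hCF : C = F := by
    by_contra hne
    have : C ∈ boundedFaces T (fun x : Q.P => (x : ℂ)) := by rw [hFb]; exact ⟨hC, hne⟩
    exact hEb (this.2.subset hEC)
  rw [← hCF]
  refine Subset.antisymm hEC ?_
  exact subset_of_mem_comps hE (comps_isPreconnected hC)
    ((comps_subset hC).trans (compl_subset_compl.2 hRD)) (hEC hz) hz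

/-- The excess of corners equals the number of reflex vertices: three convex angles from each
bounded face, and one in the unbounded face for each reflex vertex. -/
theorem IsPseudoTriangulation.ncard_convexAngles (hT : Q.IsPseudoTriangulation T) :
    (convexAngles T (fun x : Q.P => (x : ℂ))).ncard =
      3 * (boundedFaces T (fun x : Q.P => (x : ℂ))).ncard + Q.R.reflexVertices.ncard := by
  classical
  set p : Q.P → ℂ := fun x => (x : ℂ) with hpdef
  have hp : InGeneralPosition p := Q.generalPosition
  have hG : IsNonCrossing T p := hT.nonCrossing
  obtain ⟨hf, -⟩ := euler_formula hp hG hT.connected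
  obtain ⟨F, hF, -, hFb⟩ := existsUnique_unbounded_face T p
  obtain ⟨E, hE, hEb, hEbd⟩ :=
    existsUnique_unbounded_face (SimpleGraph.cycleGraph Q.R.k) Q.R.vertex
  have hEF : E = F := hT.unbounded_face_eq hE hEb hFb
  have hFm : F ∈ hf.toFinset := hf.mem_toFinset.2 hF
  rw [ncard_convexAngles_eq_sum hp hf, ← Finset.sum_erase_add _ _ hFm]
  congr 1
  · have hcard : (boundedFaces T p).ncard = (hf.toFinset.erase F).card := by
      rw [hFb, ← Set.ncard_coe_finset, Finset.coe_erase, hf.coe_toFinset]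
    rw [Finset.sum_const_nat (m := 3), hcard, mul_comm]
    intro K hK
    have hKb : K ∈ boundedFaces T p := by
      rw [Finset.mem_erase, hf.mem_toFinset] at hK
      rw [hFb]
      exact ⟨hK.2, hK.1⟩
    exact ncard_convexAngles_of_isPseudoTriangularFace hp hG hKb.1 (hT.face_pseudoTriangle K hKb)
  · rw [Q.R.reflexVertices_eq hE hEbd, ← Q.R.ncard_convexAngles_facing E]
    have hsat : IsSaturated (drawing (SimpleGraph.cycleGraph Q.R.k)
        (p ∘ fun i => ⟨Q.R.vertex i, Q.vertex_mem i⟩))ᶜ F := hEF ▸ isSaturated_of_mem_comps hE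
    have hinj : Function.Injective fun i => (⟨Q.R.vertex i, Q.vertex_mem i⟩ : Q.P) :=
      fun i j e => Q.R.generalPosition.1 (congrArg Subtype.val e)
    rw [ncard_convexAngles_facing hp hG hinj hT.boundary_adj (isSaturated_of_mem_comps hF) hsat,
      hEF]
    rfl

end Pointgon

end

/-! ### Elimination from the linear relations. -/

theorem mainTheorem9 :
    (∀ (Q : Pointgon) (T : SimpleGraph Q.P), Q.IsPseudoTriangulation T →
      (T.edgeSet.ncard : ℤ) = 2 * (Q.P.card : ℤ) - 3 +
          ((numNonPointed T (fun x : Q.P => (x : ℂ)) : ℤ) - (Q.R.reflexVertices.ncard : ℤ)) ∧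
      (boundedFaces T (fun x : Q.P => (x : ℂ))).Finite ∧
      ((boundedFaces T (fun x : Q.P => (x : ℂ))).ncard : ℤ) = (Q.P.card : ℤ) - 2 +
          ((numNonPointed T (fun x : Q.P => (x : ℂ)) : ℤ) - (Q.R.reflexVertices.ncard : ℤ))) ∧
    (∀ (V : Type*) [Fintype V] (G : SimpleGraph V) (p : V → ℂ),
      InGeneralPosition p → IsNonCrossing G p → G.Connected →
      (boundedFaces G p).Finite ∧
      (G.edgeSet.ncard : ℤ) = 2 * (Fintype.card V : ℤ) - 3 +
          ((numNonPointed G p : ℤ) - excessOfCorners G p)) := by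
  refine ⟨fun Q T hT => ?_, fun V _ G p hp hG hc => edges_eq_of_connected hp hG hc⟩
  obtain ⟨hf, h1⟩ := ncard_boundedFaces Q.generalPosition hT.nonCrossing hT.connected
  have h2 := ncard_convexAngles Q.generalPosition T
  have h3 := hT.ncard_convexAngles
  rw [Nat.card_eq_fintype_card, Fintype.card_coe] at h1 h2
  -- The relations f = m - n + 1, c = 2m - n + n_np and c = 3f + r determine m and f.
  refine ⟨?_, hf, ?_⟩ <;> omega
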